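/- **Definitions.** A strict partition is a finite strictly decreasing sequence $\lambda=(\lambda_1>\lambda_2>\dots>0)$ of positive integers (possibly empty), with $\lambda_i:=0$ beyond its last part. Its shifted diagram is $\mathsf{SD}_\lambda=\{(i,j)\in\mathbb Z\times\mathbb Z: 0<i\le j<i+\lambda_i\}$. For strict partitions with $\mu_i\le\lambda_i$ for all $i$, write $\mu\subseteq\lambda$; the skew shape $\lambda/\mu$ has diagram $\mathsf{SD}_{\lambda/\mu}=\mathsf{SD}_\lambda\setminus\mathsf{SD}_\mu$ and $|\lambda/\mu|:=|\mathsf{SD}_{\lambda/\mu}|$. For an integer $i\geq 1$ let $i':=i-\frac12$; the numbers $i'$ are called primed and the integers $i$ unprimed. A semistandard set-valued shifted tableau $T$ of shape $\lambda/\mu$ is a filling of $\mathsf{SD}_{\lambda/\mu}$ by nonempty finite subsets $T_{ij}$ of $\{1'<1<2'<2<\cdots\}$ such that (a) rows and columns are weakly increasing, i.e. if one box precedes another in the same row (or the same column), then the maximum of its entry is at most the minimum of the other's; (b) no unprimed number occurs in two boxes of the same column; (c) no primed number occurs in two boxes of the same row. Let $\mathrm{SetShYT}_Q(\lambda/\mu)$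 be the set of all such $T$, and $\mathrm{SetShYT}_P(\lambda/\mu)$ the subset of those with no primed number in any diagonal box $(j,j)$. Put $|T|=\sum_{(i,j)}|T_{ij}|$ and $x^T=\prod_{i\ge1}x_i^{m_i}$, where $m_i$ is the number of times $i$ or $i'$ appears in $T$. In $\mathbb Z[\beta][[x_1,x_2,\dots]]$ define $$GP_{\lambda/\mu}=\sum_{T\in \mathrm{SetShYT}_P(\lambda/\mu)}\beta^{|T|-|\lambda/\mu|}x^T,\qquad GQ_{\lambda/\mu}=\sum_{T\in \mathrm{SetShYT}_Q(\lambda/\mu)}\beta^{|T|-|\lambda/\mu|}x^T .$$ A flip $\phi(\lambda/\mu)$ of $\lambda/\mu$ is a skew shape whose shifted diagram is the image of $\mathsf{SD}_{\lambda/\mu}$ under the reflection $(i,j)\mapsto(c-j,c-i)$ across the line $i+j=c$ (perpendicular to the main diagonal), for some integer $c$. **Proposition.** Let $\mu\subseteq\lambda$ be strict partitions. Then $\lambda/\mu$ has a flip, and every flip $\phi(\lambda/\mu)$ satisfies $$GP_{\phi(\lambda/\mu)}=GP_{\lambda/\mu}\qquad\text{and}\qquad GQ_{\phi(\lambda/\mu)}=GQ_{\lambda/\mu}.$$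 -/

import Mathlib

noncomputable section

/-- A strict partition `λ = (λ₁ > λ₂ > ⋯ > 0)`: a finite strictly decreasing list of positive
integers (possibly empty). -/
structure StrictPartition where
  parts : List ℕ
  strict : parts.Pairwise (· > ·)
  pos : ∀ p ∈ parts, 0 < p

namespace StrictPartition

/-- `λᵢ` for an integer `i ≥ 1`, with `λᵢ = 0` beyond the last part. (Only `i ≥ 1` is used.) -/
def part (lam : StrictPartition) (i : ℤ) : ℕ := lam.parts.getD (i - 1).toNat 0

/-- `μ ⊆ λ` means `μᵢ ≤ λᵢ` for all `i ≥ 1`. -/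
instance : HasSubset StrictPartition :=
  ⟨fun mu lam => ∀ i : ℤ, 1 ≤ i → mu.part i ≤ lam.part i⟩

/-- The shifted diagram `SD_λ = {(i, j) ∈ ℤ × ℤ : 0 < i ≤ j < i + λᵢ}`; see `mem_SD`. -/
def SD (lam : StrictPartition) : Finset (ℤ × ℤ) :=
  (Finset.Icc (1 : ℤ) lam.parts.length).biUnion fun i =>
    (Finset.Ico i (i + lam.part i)).image fun j => (i, j)

theorem mem_SD (lam : StrictPartition) (i j : ℤ) :
    (i, j) ∈ lam.SD ↔ 0 < i ∧ i ≤ j ∧ j < i + lam.part i := by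
  simp only [SD, Finset.mem_biUnion, Finset.mem_Icc, Finset.mem_image, Finset.mem_Ico,
    Prod.mk.injEq]
  constructor
  · rintro ⟨i', ⟨h1, h2⟩, j', ⟨h3, h4⟩, rfl, rfl⟩
    exact ⟨by omega, h3, h4⟩
  · rintro ⟨h1, h2, h3⟩
    refine ⟨i, ⟨by omega, ?_⟩, j, ⟨h2, h3⟩, rfl, rfl⟩
    by_contra hlen
    have h0 : lam.part i = 0 := by
      unfold part
      exact List.getD_eq_default _ _ (by omega)
    rw [h0] at h3
    push_cast at h3
    omega

end StrictPartition

/-- A skew shape `λ/μ`, where `μ ⊆ λ` are strict partitions. -/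
structure SkewShape where
  outer : StrictPartition
  inner : StrictPartition
  sub : inner ⊆ outer

namespace SkewShape

/-- `SD_{λ/μ} = SD_λ \ SD_μ`. -/
def SD (S : SkewShape) : Finset (ℤ × ℤ) := S.outer.SD \ S.inner.SD

/-- Reflection of `ℤ × ℤ` across the line `i + j = c`, which is perpendicular to the main
diagonal `i = j`. -/
def reflect (c : ℤ) (p : ℤ × ℤ) : ℤ × ℤ := (c - p.2, c - p.1)

/-- `S'` is a flip of `S`: the diagram of `S'` is the reflection of the diagram of `S` across
some line perpendicular to the main diagonal. -/
def IsFlip (S S' : SkewShape) : Prop := ∃ c : ℤ, S'.SD = S.SD.image (reflect c)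

end SkewShape

/-! The positive integer `k` encodes the positive half-integer `k / 2`. So `k = 2 * i` encodes the
unprimed number `i`, and `k = 2 * i - 1` encodes the primed number `i' = i - 1/2`. -/

/-- `k / 2` is a primed number, that is, not an integer. -/
def IsPrimed (k : ℕ+) : Prop := Odd (k : ℕ)

/-- The index `i` such that `k / 2` is `i` or `i'`. -/
def letterIndex (k : ℕ+) : ℕ+ := ⟨((k : ℕ) + 1) / 2, by have := k.pos; omega⟩

/-- A filling of the diagram of `S` by finite sets of positive half-integers. -/
abbrev SetFilling (S : SkewShape) : Type := {b : ℤ × ℤ // b ∈ S.SD} → Finset ℕ+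

/-- The set-valued shifted tableaux of skew shape `S` that are semistandard. -/
structure IsSemistandard {S : SkewShape} (T : SetFilling S) : Prop where
  nonempty : ∀ b, (T b).Nonempty
  /-- Rows are weakly increasing: the maximum of each entry is at most the minimum of any later
  entry in the row. -/
  row_le : ∀ a b, a.1.1 = b.1.1 → a.1.2 < b.1.2 → ∀ k ∈ T a, ∀ l ∈ T b, k ≤ l
  /-- Columns are weakly increasing. -/
  col_le : ∀ a b, a.1.2 = b.1.2 → a.1.1 < b.1.1 → ∀ k ∈ T a, ∀ l ∈ T b, k ≤ l
  /-- No unprimed number occurs more than once in a column. -/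
  col_unprimed : ∀ a b, a.1.2 = b.1.2 → ∀ k, ¬ IsPrimed k → k ∈ T a → k ∈ T b → a = b
  /-- No primed number occurs more than once in a row. -/
  row_primed : ∀ a b, a.1.1 = b.1.1 → ∀ k, IsPrimed k → k ∈ T a → k ∈ T b → a = b

/-- `SetShYT_Q(λ/μ)`. -/
def SetShYTQ (S : SkewShape) : Set (SetFilling S) := {T | IsSemistandard T}

/-- `SetShYT_P(λ/μ)`: no primed number occurs in a diagonal position. -/
def SetShYTP (S : SkewShape) : Set (SetFilling S) :=
  {T | IsSemistandard T ∧ ∀ b, b.1.1 = b.1.2 → ∀ k ∈ T b, ¬ IsPrimed k}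

namespace SetFilling

variable {S : SkewShape}

/-- The exponent vector of `x^T`: its value at `i` is the number of times that `i` or `i'`
appears in `T`. -/
def weight (T : SetFilling S) : ℕ+ →₀ ℕ := ∑ b, ∑ k ∈ T b, Finsupp.single (letterIndex k) 1

/-- `|T|`, the total number of elements of the entries of `T`. -/
def size (T : SetFilling S) : ℕ := ∑ b, (T b).card

/-- Only finitely many fillings have a given weight. -/
theorem finite_weight (A : Set (SetFilling S)) (m : ℕ+ →₀ ℕ) :
    {T : SetFilling S | T ∈ A ∧ T.weight = m}.Finite := by
  set L : Finset ℕ+ := m.support.biUnion fun i => Finset.Icc 1 (2 * i) with hL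
  refine Set.Finite.subset (Set.Finite.pi' fun _ => (L.powerset.finite_toSet)) ?_
  rintro T ⟨-, hT⟩ b
  simp only [Finset.mem_coe, Finset.mem_powerset]
  intro k hk
  rw [hL, Finset.mem_biUnion]
  refine ⟨letterIndex k, ?_, ?_⟩
  · rw [← hT, Finsupp.mem_support_iff]
    have h1 : (1 : ℕ) ≤ (weight T) (letterIndex k) := by
      have e : (weight T) (letterIndex k) =
          ∑ b, ∑ l ∈ T b, (Finsupp.single (letterIndex l) 1 : ℕ+ →₀ ℕ) (letterIndex k) := by
        simp only [weight, Finsupp.finsetSum_apply]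
      rw [e]
      calc (1 : ℕ) = (Finsupp.single (letterIndex k) 1 : ℕ+ →₀ ℕ) (letterIndex k) := by simp
        _ ≤ ∑ l ∈ T b, (Finsupp.single (letterIndex l) 1 : ℕ+ →₀ ℕ) (letterIndex k) :=
            Finset.single_le_sum
              (f := fun l => (Finsupp.single (letterIndex l) 1 : ℕ+ →₀ ℕ) (letterIndex k))
              (fun _ _ => Nat.zero_le _) hk
        _ ≤ _ := Finset.single_le_sum
              (f := fun b => ∑ l ∈ T b,
                (Finsupp.single (letterIndex l) 1 : ℕ+ →₀ ℕ) (letterIndex k))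
              (fun _ _ => Nat.zero_le _) (Finset.mem_univ b)
    omega
  · rw [Finset.mem_Icc]
    refine ⟨one_le, ?_⟩
    rw [← PNat.coe_le_coe, PNat.mul_coe]
    simp only [letterIndex, PNat.mk_coe, PNat.val_ofNat]
    omega

end SetFilling

/-- The generating function `∑_{T ∈ A} β^{|T| - |λ/μ|} x^T` in `ℤ[β][[x₁, x₂, …]]`, given by its
coefficients: that of `x^m` is the (finite) sum of `β^{|T| - |λ/μ|}` over the `T ∈ A` with
`x^T = x^m`. Here `β` is the variable of `ℤ[β] = Polynomial ℤ`. When all entries of `T` are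
nonempty, `|λ/μ| ≤ |T|`, so the subtraction is genuine. -/
def tableauGenFun {S : SkewShape} (A : Set (SetFilling S)) : MvPowerSeries ℕ+ (Polynomial ℤ) :=
  fun m => ∑ T ∈ (SetFilling.finite_weight A m).toFinset,
    (Polynomial.X : Polynomial ℤ) ^ (T.size - S.SD.card)

/-- The skew `K`-theoretic Schur `P`-function `GP_{λ/μ}`. -/
def GP (S : SkewShape) : MvPowerSeries ℕ+ (Polynomial ℤ) := tableauGenFun (SetShYTP S)

/-- The skew `K`-theoretic Schur `Q`-function `GQ_{λ/μ}`. -/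
def GQ (S : SkewShape) : MvPowerSeries ℕ+ (Polynomial ℤ) := tableauGenFun (SetShYTQ S)

end

/-!
Reflecting a tableau in a line perpendicular to the main diagonal exchanges rows with columns and
reverses their direction, so it becomes semistandard again once the alphabet `1' < 1 < ⋯ < n' < n` is
reversed as well. This reverses the variables `x₁, …, x_n`, and for `GP` it also turns the condition
that no primed number is on the diagonal into the one that no unprimed number is there. What has to
be shown is that neither change matters, and both follow from a description of the generating
functions by operators which satisfy Yang–Baxter equations.

Give the letter `k` in a box of content `c` the time `letterTime N k c`: times are ordered by letter,
then by increasing content for unprimed and by decreasing content for primed letters. A filling is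
semistandard exactly if times increase strictly along the componentwise order of boxes
(`timesOf_mem_timedFillings`, `isSemistandard_lettersOf`). Removing the last time from such a filling
either removes a maximal box or leaves the shape unchanged, so the generating function is obtained by
applying to the indicator function of the empty shape a product of operators `h_c(x) = 1 + x u_c`, one
for each time (`timedSum_eq_prod`). Here `u_c` is `cornerOp β c`, which removes a corner of content `c`
or keeps it with a factor `β`. For the letters `i'` and `i` the product is the palindrome
`B(x_i) = h_N(x_i) ⋯ h_1(x_i) h_0(p_i) h_1(x_i) ⋯ h_N(x_i)`, where `p_i = x_i` for `GP` and
`p_i = 2 x_i + β x_i²` for `GQ`.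

A reflection preserves contents and reverses the order of boxes, so its effect is to reverse the
product of operators (`timedSum_reflect`). As each `B(x_i)` is a palindrome, this only reverses the
order of the factors `B(x_i)`, and it remains to show that these commute. The operators satisfy
`u_c² = β u_c`, `u_c u_d = u_d u_c` for `|c - d| ≥ 2`, and `u_c u_d u_c = 0` for `|c - d| = 1` unless
`c = 0`. Hence they satisfy the Yang–Baxter equation `yangBaxter` and, at the diagonal, the reflection
equation `reflection_base`; by induction on `N` these give `palindrome_reflection` and
`palindrome_commute`.

Finally, a flip exists because the complement of a shifted diagram in a staircase, when reflected, is
again an order ideal of the shifted plane (`exists_SD_complement`), and the finite order ideals are the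
shifted diagrams (`exists_SD_eq`).
-/

noncomputable section

namespace ShiftedShape

open Finset
open scoped Classical

/-! ### Convex shapes and their corners -/

/-- A finite set of boxes on or above the main diagonal which is convex for the componentwise order
of `ℤ × ℤ` restricted to that region. Diagrams of skew shapes are of this kind, and so is what is
left of one after removing a maximal box. -/
structure IsShape (D : Finset (ℤ × ℤ)) : Prop where
  le : ∀ b ∈ D, b.1 ≤ b.2
  convex : ∀ a ∈ D, ∀ b ∈ D, ∀ p : ℤ × ℤ, a ≤ p → p ≤ b → p.1 ≤ p.2 → p ∈ D

/-- `b` is a maximal box of `D`, of content `c`. -/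
def IsCorner (D : Finset (ℤ × ℤ)) (c : ℕ) (b : ℤ × ℤ) : Prop :=
  Maximal (· ∈ D) b ∧ b.2 - b.1 = c

theorem IsCorner.mem {D : Finset (ℤ × ℤ)} {c : ℕ} {b : ℤ × ℤ} (h : IsCorner D c b) : b ∈ D :=
  h.1.prop

theorem IsCorner.eq_of_le {D : Finset (ℤ × ℤ)} {c : ℕ} {a b : ℤ × ℤ} (h : IsCorner D c b)
    (ha : a ∈ D) (hba : b ≤ a) : a = b :=
  h.1.eq_of_ge ha hba

/-- Boxes whose contents differ by at most one are comparable. -/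
theorem le_or_le_of_content {a b : ℤ × ℤ} (h₁ : a.2 - a.1 ≤ b.2 - b.1 + 1)
    (h₂ : b.2 - b.1 ≤ a.2 - a.1 + 1) : a ≤ b ∨ b ≤ a := by
  simp only [Prod.le_def]
  omega

theorem IsCorner.eq_of_content {D : Finset (ℤ × ℤ)} {c d : ℕ} {a b : ℤ × ℤ}
    (ha : IsCorner D c a) (hb : IsCorner D d b) (h₁ : c ≤ d + 1) (h₂ : d ≤ c + 1) : a = b := by
  have e₁ := ha.2
  have e₂ := hb.2
  rcases le_or_le_of_content (a := a) (b := b) (by omega) (by omega) with h | h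
  · exact (ha.eq_of_le hb.mem h).symm
  · exact hb.eq_of_le ha.mem h

theorem IsShape.erase {D : Finset (ℤ × ℤ)} (hD : IsShape D) {c : ℕ} {b : ℤ × ℤ}
    (hb : IsCorner D c b) : IsShape (D.erase b) where
  le a ha := hD.le a (mem_of_mem_erase ha)
  convex a ha a' ha' p hap hpa' hp := by
    refine mem_erase.2 ⟨?_, hD.convex a (mem_of_mem_erase ha) a' (mem_of_mem_erase ha') p hap hpa' hp⟩
    rintro rfl
    exact ne_of_mem_erase ha' (hb.eq_of_le (mem_of_mem_erase ha') hpa')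

/-- Between two removals of boxes of content `c > 0`, boxes of both contents `c - 1` and `c + 1` have to
be removed; for `c = 0` one of content `1`. So removing only a box of content `d` is not enough. -/
theorem IsShape.not_isCorner_erase_erase {D : Finset (ℤ × ℤ)} (hD : IsShape D) {c d : ℕ}
    (hcd : d = c + 1 ∧ 1 ≤ c ∨ c = d + 1) {b a a₀ : ℤ × ℤ} (hb : IsCorner D c b)
    (ha : IsCorner (D.erase b) d a) : ¬ IsCorner ((D.erase b).erase a) c a₀ := by
  intro h₀
  have e := hb.2
  have e₁ := ha.2
  have e₀ := h₀.2
  have hm₀ : a₀ ∈ D := mem_of_mem_erase (mem_of_mem_erase h₀.mem)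
  have hne : a₀ ≠ b := ne_of_mem_erase (mem_of_mem_erase h₀.mem)
  have hle : a₀ ≤ b := by
    rcases le_or_le_of_content (a := a₀) (b := b) (by omega) (by omega) with h | h
    · exact h
    · exact absurd (hb.eq_of_le hm₀ h) hne
  have hlt : a₀.1 < b.1 := by
    rcases lt_or_eq_of_le hle.1 with h | h
    · exact h
    · exact absurd (Prod.ext h (by omega)) hne
  have hlt2 : a₀.2 < b.2 := by omega
  -- the neighbour of `b` on the diagonal other than `d` still blocks `a₀`
  have key : ∀ p : ℤ × ℤ, a₀ ≤ p → p ≤ b → p.1 ≤ p.2 → p.2 - p.1 ≠ c → p.2 - p.1 ≠ d → False := by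
    intro p h₁ h₂ h₃ h₄ h₅
    have hp : p ∈ (D.erase b).erase a := by
      refine mem_erase.2 ⟨?_, mem_erase.2 ⟨?_, hD.convex _ hm₀ _ hb.mem p h₁ h₂ h₃⟩⟩
      · rintro rfl; exact h₅ e₁
      · rintro rfl; exact h₄ e
    have := h₀.eq_of_le hp h₁
    rw [this] at h₄
    exact h₄ e₀
  rcases hcd with ⟨rfl, hc⟩ | rfl
  · refine key (b.1, b.2 - 1) ?_ ?_ ?_ ?_ ?_ <;> simp only [Prod.le_def, ne_eq] <;>
      (push_cast at *; omega)
  · refine key (b.1 - 1, b.2) ?_ ?_ ?_ ?_ ?_ <;> simp only [Prod.le_def, ne_eq] <;>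
      (push_cast at *; omega)

/-- Removing a box does not affect corners whose content is at distance at least two. -/
theorem IsShape.isCorner_erase_iff {D : Finset (ℤ × ℤ)} (hD : IsShape D) {c d : ℕ}
    (hcd : c + 2 ≤ d ∨ d + 2 ≤ c) {a b : ℤ × ℤ} (hb : IsCorner D d b) :
    IsCorner (D.erase b) c a ↔ IsCorner D c a := by
  have e := hb.2
  constructor
  · intro ha
    have e₁ := ha.2
    have hm := mem_of_mem_erase ha.mem
    refine ⟨⟨hm, fun p hp hap => ?_⟩, e₁⟩
    by_cases hpb : p = b
    · subst hpb
      exfalso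
      -- a neighbour of `b` lies between `a` and `b`
      rcases hcd with hcd | hcd
      · have hmem : (p.1, p.2 - 1) ∈ D := by
          refine hD.convex _ hm _ hp _ ?_ ?_ ?_ <;> simp only [Prod.le_def] at * <;> omega
        have := ha.eq_of_le (mem_erase.2 ⟨fun h => by simpa using congrArg Prod.snd h, hmem⟩)
          (by simp only [Prod.le_def] at *; omega)
        rw [← this] at e₁
        simp only at e₁
        omega
      · have hal := hD.le _ hm
        have hmem : (p.1 - 1, p.2) ∈ D := by
          refine hD.convex _ hm _ hp _ ?_ ?_ ?_ <;> simp only [Prod.le_def] at * <;> omega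
        have := ha.eq_of_le (mem_erase.2 ⟨fun h => by simpa using congrArg Prod.fst h, hmem⟩)
          (by simp only [Prod.le_def] at *; omega)
        rw [← this] at e₁
        simp only at e₁
        omega
    · exact (ha.eq_of_le (mem_erase.2 ⟨hpb, hp⟩) hap).le
  · intro ha
    have e₁ := ha.2
    refine ⟨⟨mem_erase.2 ⟨?_, ha.mem⟩, fun p hp hap => ha.1.le_of_ge (mem_of_mem_erase hp) hap⟩, e₁⟩
    rintro rfl
    omega

/-! ### Operators removing corners -/

variable {R : Type*} [CommRing R]

/-- The operator on functions of shapes which sends `F` to the function with the value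
`F (D \ b) + β F (D)` at every shape `D` with a corner `b` of content `c` (there is at most one), and
the value `0` at all other `D`. -/
def cornerOp (β : R) (c : ℕ) : Module.End R (Finset (ℤ × ℤ) → R) where
  toFun F D := if IsShape D then ∑ b ∈ D with IsCorner D c b, (F (D.erase b) + β * F D) else 0
  map_add' F G := by
    ext D
    simp only [Pi.add_apply]
    split_ifs
    · rw [← sum_add_distrib]
      exact sum_congr rfl fun _ _ => by ring
    · simp
  map_smul' r F := by
    ext D
    simp only [Pi.smul_apply, smul_eq_mul, RingHom.id_apply]
    split_ifs
    · rw [mul_sum]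
      exact sum_congr rfl fun _ _ => by ring
    · simp

theorem cornerOp_apply (β : R) (c : ℕ) (F : Finset (ℤ × ℤ) → R) {D : Finset (ℤ × ℤ)}
    (hD : IsShape D) :
    cornerOp β c F D = ∑ b ∈ D with IsCorner D c b, (F (D.erase b) + β * F D) :=
  if_pos hD

theorem cornerOp_of_isCorner (β : R) {c : ℕ} (F : Finset (ℤ × ℤ) → R) {D : Finset (ℤ × ℤ)}
    (hD : IsShape D) {b : ℤ × ℤ} (hb : IsCorner D c b) :
    cornerOp β c F D = F (D.erase b) + β * F D := by
  have : D.filter (IsCorner D c) = {b} := by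
    ext a
    simp only [mem_filter, mem_singleton]
    constructor
    · rintro ⟨-, ha⟩
      exact ha.eq_of_content hb (by omega) (by omega)
    · rintro rfl
      exact ⟨hb.mem, hb⟩
  rw [cornerOp_apply _ _ _ hD, this, sum_singleton]

theorem cornerOp_of_not_isCorner (β : R) {c : ℕ} (F : Finset (ℤ × ℤ) → R) {D : Finset (ℤ × ℤ)}
    (h : IsShape D → ∀ b, ¬ IsCorner D c b) : cornerOp β c F D = 0 := by
  by_cases hD : IsShape D
  · rw [cornerOp_apply _ _ _ hD, filter_false_of_mem fun b _ => h hD b, sum_empty]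
  · exact if_neg hD

theorem cornerOp_congr (β : R) (c : ℕ) {F G : Finset (ℤ × ℤ) → R}
    (h : ∀ D, IsShape D → F D = G D) {D : Finset (ℤ × ℤ)} (hD : IsShape D) :
    cornerOp β c F D = cornerOp β c G D := by
  rw [cornerOp_apply _ _ _ hD, cornerOp_apply _ _ _ hD]
  refine sum_congr rfl fun b hb => ?_
  rw [h D hD, h _ (hD.erase (mem_filter.1 hb).2)]

theorem cornerOp_mul_self (β : R) (c : ℕ) :
    cornerOp β c * cornerOp β c = β • cornerOp β c := by
  ext F D
  simp only [Module.End.mul_apply, LinearMap.smul_apply, Pi.smul_apply, smul_eq_mul]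
  by_cases h : IsShape D ∧ ∃ b, IsCorner D c b
  · obtain ⟨hD, b, hb⟩ := h
    rw [cornerOp_of_isCorner β (cornerOp β c F) hD hb,
      cornerOp_of_not_isCorner (D := D.erase b), zero_add]
    intro _ a ha
    -- a second corner of the same content would be blocked by a neighbour of `b`
    have e := hb.2
    have e₁ := ha.2
    have hm := mem_of_mem_erase ha.mem
    have hne := ne_of_mem_erase ha.mem
    have hle : a ≤ b := by
      rcases le_or_le_of_content (a := a) (b := b) (by omega) (by omega) with h | h
      · exact h
      · exact absurd (hb.eq_of_le hm h) hne
    have hlt : a.1 < b.1 := by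
      rcases lt_or_eq_of_le hle.1 with h | h
      · exact h
      · exact absurd (Prod.ext h (by omega)) hne
    have hmem : (b.1 - 1, b.2) ∈ D := by
      refine hD.convex _ hm _ hb.mem _ ?_ ?_ ?_ <;> simp only [Prod.le_def] at * <;> omega
    have := ha.eq_of_le (mem_erase.2 ⟨fun h => by simpa using congrArg Prod.fst h, hmem⟩)
      (by simp only [Prod.le_def] at *; omega)
    rw [← this] at e₁
    simp only at e₁
    omega
  · have h' : IsShape D → ∀ b, ¬ IsCorner D c b := by
      intro hD b hb
      exact h ⟨hD, b, hb⟩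
    rw [cornerOp_of_not_isCorner _ _ h', cornerOp_of_not_isCorner _ _ h', mul_zero]

theorem cornerOp_mul_mul_eq_zero (β : R) {c d : ℕ} (hcd : d = c + 1 ∧ 1 ≤ c ∨ c = d + 1) :
    cornerOp β c * cornerOp β d * cornerOp β c = 0 := by
  -- a shape cannot have corners of both contents
  have excl : ∀ {D a b}, IsCorner D c a → IsCorner D d b → False := by
    intro D a b ha hb
    have e := ha.2
    have := ha.eq_of_content hb (by omega) (by omega)
    rw [this, hb.2] at e
    omega
  ext F D
  simp only [Module.End.mul_apply, LinearMap.zero_apply, Pi.zero_apply]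
  by_cases h : IsShape D ∧ ∃ b, IsCorner D c b
  · obtain ⟨hD, b, hb⟩ := h
    have hD₁ := hD.erase hb
    rw [cornerOp_of_isCorner β _ hD hb,
      cornerOp_of_not_isCorner (D := D) β _ (fun _ a ha => excl hb ha), mul_zero, add_zero]
    by_cases h' : ∃ a, IsCorner (D.erase b) d a
    · obtain ⟨a, ha⟩ := h'
      rw [cornerOp_of_isCorner β _ hD₁ ha,
        cornerOp_of_not_isCorner (D := D.erase b) β _ (fun _ a' ha' => excl ha' ha), mul_zero,
        add_zero, cornerOp_of_not_isCorner]
      exact fun _ a₀ => hD.not_isCorner_erase_erase hcd hb ha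
    · exact cornerOp_of_not_isCorner _ _ fun _ a ha => h' ⟨a, ha⟩
  · exact cornerOp_of_not_isCorner _ _ fun hD b hb => h ⟨hD, b, hb⟩

theorem cornerOp_commute (β : R) {c d : ℕ} (hcd : c + 2 ≤ d) :
    Commute (cornerOp β c) (cornerOp β d) := by
  ext F D
  simp only [Module.End.mul_apply]
  by_cases hD : IsShape D
  swap
  · rw [cornerOp_of_not_isCorner _ _ fun h => absurd h hD,
      cornerOp_of_not_isCorner _ _ fun h => absurd h hD]
  by_cases hc : ∃ b, IsCorner D c b <;> by_cases hd : ∃ b, IsCorner D d b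
  · obtain ⟨b, hb⟩ := hc
    obtain ⟨a, ha⟩ := hd
    have ha' := (hD.isCorner_erase_iff (Or.inr hcd) hb).2 ha
    have hb' := (hD.isCorner_erase_iff (Or.inl hcd) ha).2 hb
    rw [cornerOp_of_isCorner β _ hD hb, cornerOp_of_isCorner β _ hD ha,
      cornerOp_of_isCorner β _ hD ha, cornerOp_of_isCorner β _ hD hb,
      cornerOp_of_isCorner β _ (hD.erase hb) ha', cornerOp_of_isCorner β _ (hD.erase ha) hb',
      erase_right_comm]
    ring
  · obtain ⟨b, hb⟩ := hc
    rw [cornerOp_of_isCorner β _ hD hb,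
      cornerOp_of_not_isCorner (D := D) _ _ fun _ a ha => hd ⟨a, ha⟩,
      cornerOp_of_not_isCorner (D := D) _ _ fun _ a ha => hd ⟨a, ha⟩, cornerOp_of_not_isCorner]
    · simp
    · exact fun _ a ha => hd ⟨a, (hD.isCorner_erase_iff (Or.inr hcd) hb).1 ha⟩
  · obtain ⟨a, ha⟩ := hd
    rw [cornerOp_of_isCorner β (c := d) _ hD ha,
      cornerOp_of_not_isCorner (D := D) _ _ fun _ a ha => hc ⟨a, ha⟩,
      cornerOp_of_not_isCorner (D := D) _ _ fun _ a ha => hc ⟨a, ha⟩, cornerOp_of_not_isCorner]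
    · simp
    · exact fun _ b hb => hc ⟨b, (hD.isCorner_erase_iff (Or.inl hcd) ha).1 hb⟩
  · rw [cornerOp_of_not_isCorner _ _ fun _ a ha => hc ⟨a, ha⟩,
      cornerOp_of_not_isCorner _ _ fun _ a ha => hd ⟨a, ha⟩]

/-! ### The Yang–Baxter and reflection equations -/

section YangBaxter

variable {A : Type*} [Ring A] [Algebra R A]

theorem one_add_smul_mul {β : R} {a : A} (ha : a * a = β • a) (x y : R) :
    (1 + x • a) * (1 + y • a) = 1 + (x + y + β * x * y) • a := by
  simp only [mul_add, add_mul, one_mul, mul_one, smul_mul_assoc, mul_smul_comm, ha]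
  module

theorem yangBaxter {β : R} {a b : A} (ha : a * a = β • a) (hb : b * b = β • b)
    (haba : a * b * a = 0) (hbab : b * a * b = 0) {x y s : R} (hs : s = x + y + β * x * y) :
    (1 + x • a) * (1 + s • b) * (1 + y • a) = (1 + y • b) * (1 + s • a) * (1 + x • b) := by
  simp only [mul_add, add_mul, one_mul, mul_one, smul_mul_assoc, mul_smul_comm, ha, hb, haba,
    hbab, hs]
  module

/-- The reflection equation at the main diagonal, where `a * b * a` need not vanish. The last
hypothesis is the identity of parameters that it amounts to. -/
theorem reflection_base {β : R} {a b : A} (ha : a * a = β • a) (hb : b * b = β • b)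
    (hbab : b * a * b = 0) {p q s z : R}
    (h : p * (s + z + β * s * z) + q * z * (1 + β * p) = s * q) :
    (1 + p • a) * (1 + s • b) * (1 + q • a) * (1 + z • b) =
      (1 + z • b) * (1 + q • a) * (1 + s • b) * (1 + p • a) := by
  have h₁ : a * b * b = β • (a * b) := by rw [mul_assoc, hb, mul_smul_comm]
  have h₂ : b * a * a = β • (b * a) := by rw [mul_assoc, ha, mul_smul_comm]
  have h₃ : a * b * a * b = 0 := by rw [mul_assoc, mul_assoc, ← mul_assoc b, hbab, mul_zero]
  simp only [mul_add, add_mul, one_mul, mul_one, smul_mul_assoc, mul_smul_comm, ha, hb, hbab,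
    h₁, h₂, h₃, zero_mul, smul_zero]
  linear_combination (norm := module) h • (a * b - b * a)

variable (u : ℕ → A)

/-- The palindromic product `h_N(x) ⋯ h_1(x) h_0(p) h_1(x) ⋯ h_N(x)`, where
`h_c(x) = 1 + x u_c`. -/
def palindrome (p x : R) : ℕ → A
  | 0 => 1 + p • u 0
  | N + 1 => (1 + x • u (N + 1)) * palindrome p x N * (1 + x • u (N + 1))

variable {u} {β : R}

theorem commute_palindrome (hcomm : ∀ c d, c + 2 ≤ d → Commute (u c) (u d)) (p x y : R) {N d : ℕ}
    (hd : N + 2 ≤ d) : Commute (palindrome u p x N) (1 + y • u d) := by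
  have h : ∀ (z : R) c, c + 2 ≤ d → Commute (1 + z • u c) (1 + y • u d) := fun z c hc =>
    (Commute.one_left _).add_left
      ((Commute.one_right _).add_right (((hcomm c d hc).smul_left z).smul_right y))
  induction N with
  | zero => exact h p 0 hd
  | succ N ih => exact ((h x _ hd).mul_left (ih (by omega))).mul_left (h x _ hd)

variable (hsq : ∀ c, u c * u c = β • u c) (hcomm : ∀ c d, c + 2 ≤ d → Commute (u c) (u d))
  (hup : ∀ c, 1 ≤ c → u c * u (c + 1) * u c = 0) (hdown : ∀ c, u (c + 1) * u c * u (c + 1) = 0)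

include hsq hcomm hup hdown

/-- The reflection equation. The step from `N` to `N + 1` moves the factors of index `N + 2` through
the palindromes of length `N`, by repeated use of `yangBaxter`. -/
theorem palindrome_reflection {p q x y z s : R} (hy : y = z + x + β * z * x)
    (hs : s = x + y + β * x * y)
    (h : p * (s + z + β * s * z) + q * z * (1 + β * p) = s * q) (N : ℕ) :
    palindrome u p x N * (1 + s • u (N + 1)) * palindrome u q y N * (1 + z • u (N + 1)) =
      (1 + z • u (N + 1)) * palindrome u q y N * (1 + s • u (N + 1)) * palindrome u p x N := by
  induction N with
  | zero => exact reflection_base (hsq 0) (hsq 1) (hdown 0) h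
  | succ N ih =>
    have y₁ := yangBaxter (hsq (N + 1)) (hsq (N + 2)) (hup _ (by omega)) (hdown _) hs
    have y₂ := yangBaxter (hsq (N + 1)) (hsq (N + 2)) (hup _ (by omega)) (hdown _) hy
    have y₃ := yangBaxter (x := y) (y := x) (hsq (N + 1)) (hsq (N + 2)) (hup _ (by omega))
      (hdown _) (hs.trans (by ring))
    have c₁ := (commute_palindrome hcomm p x y (le_refl (N + 2))).eq
    have c₂ := (commute_palindrome hcomm q y x (le_refl (N + 2))).eq
    have y₄ := yangBaxter (x := x) (y := z) (hsq (N + 1)) (hsq (N + 2)) (hup _ (by omega))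
      (hdown _) (hy.trans (by ring))
    simp only [palindrome]
    rw [show N + 1 + 1 = N + 2 from rfl]
    generalize palindrome u p x N = P at *
    generalize palindrome u q y N = Q at *
    generalize (1 + x • u (N + 1)) = ax at *
    generalize (1 + y • u (N + 1)) = ay at *
    generalize (1 + z • u (N + 1)) = az at *
    generalize (1 + s • u (N + 1)) = as at *
    generalize (1 + x • u (N + 2)) = bx at *
    generalize (1 + y • u (N + 2)) = by' at *
    generalize (1 + z • u (N + 2)) = bz at *
    generalize (1 + s • u (N + 2)) = bs at *
    calc ax * P * ax * bs * (ay * Q * ay) * bz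
        = ax * P * (ax * bs * ay) * Q * ay * bz := by noncomm_ring
      _ = ax * (P * by') * as * (bx * Q) * ay * bz := by rw [y₁]; noncomm_ring
      _ = ax * by' * P * as * Q * (bx * ay * bz) := by rw [c₁, ← c₂]; noncomm_ring
      _ = ax * by' * (P * as * Q * az) * by' * ax := by rw [← y₂]; noncomm_ring
      _ = (ax * by' * az) * Q * as * P * by' * ax := by rw [ih]; noncomm_ring
      _ = bz * ay * (bx * Q) * as * (P * by') * ax := by rw [y₄]; noncomm_ring
      _ = bz * ay * Q * (bx * as * by') * P * ax := by rw [c₁, ← c₂]; noncomm_ring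
      _ = bz * (ay * Q * ay) * bs * (ax * P * ax) := by rw [← y₃]; noncomm_ring

theorem palindrome_commute {p q x y z s : R} (hy : y = z + x + β * z * x)
    (hs : s = x + y + β * x * y)
    (h : p * (s + z + β * s * z) + q * z * (1 + β * p) = s * q) (N : ℕ) :
    Commute (palindrome u p x N) (palindrome u q y N) := by
  cases N with
  | zero =>
    simp only [palindrome, Commute, SemiconjBy]
    rw [one_add_smul_mul (hsq 0), one_add_smul_mul (hsq 0)]
    congr 2
    ring
  | succ N =>
    have r := palindrome_reflection hsq hcomm hup hdown hy hs h N
    have m₁ := one_add_smul_mul (hsq (N + 1)) x y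
    have m₂ := one_add_smul_mul (hsq (N + 1)) y x
    have m₃ := one_add_smul_mul (hsq (N + 1)) z x
    have m₄ := one_add_smul_mul (hsq (N + 1)) x z
    rw [← hs] at m₁
    rw [show y + x + β * y * x = s by rw [hs]; ring] at m₂
    rw [← hy] at m₃
    rw [show x + z + β * x * z = y by rw [hy]; ring] at m₄
    simp only [palindrome, Commute, SemiconjBy]
    generalize palindrome u p x N = P at *
    generalize palindrome u q y N = Q at *
    generalize (1 + x • u (N + 1)) = ax at *
    generalize (1 + y • u (N + 1)) = ay at *
    generalize (1 + z • u (N + 1)) = az at *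
    generalize (1 + s • u (N + 1)) = as at *
    calc ax * P * ax * (ay * Q * ay) = ax * P * (ax * ay) * Q * ay := by noncomm_ring
      _ = ax * (P * as * Q * az) * ax := by rw [m₁, ← m₃]; noncomm_ring
      _ = (ax * az) * Q * as * P * ax := by rw [r]; noncomm_ring
      _ = ay * Q * ay * (ax * P * ax) := by rw [m₄, ← m₂]; noncomm_ring

end YangBaxter

/-! ### Timed fillings -/

/-- A filling of `D` by nonempty sets of times, given as the set `P` of pairs (box, time). The time
`t` may only be used in boxes of content `w t`, and times increase strictly along the componentwise
order of boxes. Consequently no time is used twice. -/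
structure IsTimed (w : ℕ → ℕ) (D : Finset (ℤ × ℤ)) (P : Finset ((ℤ × ℤ) × ℕ)) : Prop where
  exists_time : ∀ b ∈ D, ∃ t, (b, t) ∈ P
  content : ∀ b t, (b, t) ∈ P → b.2 - b.1 = w t
  lt : ∀ a s b t, (a, s) ∈ P → (b, t) ∈ P → a < b → s < t

/-- The timed fillings of `D` which use times less than `M`. -/
def timedFillings (w : ℕ → ℕ) (D : Finset (ℤ × ℤ)) (M : ℕ) : Finset (Finset ((ℤ × ℤ) × ℕ)) :=
  (D ×ˢ range M).powerset.filter (IsTimed w D)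

theorem mem_timedFillings {w : ℕ → ℕ} {D : Finset (ℤ × ℤ)} {M : ℕ} {P : Finset ((ℤ × ℤ) × ℕ)} :
    P ∈ timedFillings w D M ↔ (∀ b t, (b, t) ∈ P → b ∈ D ∧ t < M) ∧ IsTimed w D P := by
  simp [timedFillings, subset_iff]

/-- The generating function of timed fillings of `D` by times less than `M`, where `x t` is the
weight of the time `t`. -/
def timedSum (β : R) (w : ℕ → ℕ) (x : ℕ → R) (D : Finset (ℤ × ℤ)) (M : ℕ) : R :=
  ∑ P ∈ timedFillings w D M, β ^ (#P - #D) * ∏ q ∈ P, x q.2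

theorem card_le_of_mem_timedFillings {w : ℕ → ℕ} {D : Finset (ℤ × ℤ)} {M : ℕ}
    {P : Finset ((ℤ × ℤ) × ℕ)} (hP : P ∈ timedFillings w D M) : #D ≤ #P := by
  refine (card_le_card fun b hb => ?_).trans (card_image_le (f := Prod.fst))
  obtain ⟨t, ht⟩ := (mem_timedFillings.1 hP).2.exists_time b hb
  exact mem_image_of_mem Prod.fst ht

theorem timedSum_zero (β : R) (w : ℕ → ℕ) (x : ℕ → R) (D : Finset (ℤ × ℤ)) :
    timedSum β w x D 0 = if D = ∅ then 1 else 0 := by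
  have h : ∀ P, P ∈ timedFillings w D 0 ↔ P = ∅ ∧ D = ∅ := by
    intro P
    rw [mem_timedFillings]
    constructor
    · rintro ⟨h₁, h₂⟩
      have hP : P = ∅ := eq_empty_of_forall_notMem fun q hq => absurd (h₁ q.1 q.2 hq).2 (by omega)
      refine ⟨hP, eq_empty_of_forall_notMem fun b hb => ?_⟩
      obtain ⟨t, ht⟩ := h₂.exists_time b hb
      simp [hP] at ht
    · rintro ⟨rfl, rfl⟩
      exact ⟨by simp, ⟨by simp, by simp, by simp⟩⟩
  split_ifs with hD
  · have : timedFillings w D 0 = {∅} := by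
      ext P
      rw [h, mem_singleton, and_iff_left hD]
    rw [timedSum, this]
    simp [hD]
  · have : timedFillings w D 0 = ∅ := eq_empty_of_forall_notMem fun P hP => hD ((h P).1 hP).2
    simp [timedSum, this]

/-- The box in which the last time is used is maximal. -/
theorem isCorner_of_mem_timedFillings {w : ℕ → ℕ} {D : Finset (ℤ × ℤ)} {M : ℕ}
    {P : Finset ((ℤ × ℤ) × ℕ)} (hP : P ∈ timedFillings w D (M + 1)) {b : ℤ × ℤ} (hb : (b, M) ∈ P) :
    IsCorner D (w M) b := by
  obtain ⟨h₁, h₂⟩ := mem_timedFillings.1 hP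
  refine ⟨⟨(h₁ _ _ hb).1, fun a ha hba => ?_⟩, h₂.content _ _ hb⟩
  by_contra hab
  obtain ⟨t, ht⟩ := h₂.exists_time a ha
  have := h₂.lt _ _ _ _ hb ht (lt_of_le_not_ge hba hab)
  have := (h₁ _ _ ht).2
  omega

/-- Removing the last time from a timed filling leaves a timed filling of the same shape, or one of
the shape without the box in which the last time was used. -/
theorem sum_timedFillings_of_isCorner (β : R) (w : ℕ → ℕ) (x : ℕ → R) {D : Finset (ℤ × ℤ)} (M : ℕ)
    {b : ℤ × ℤ} (hb : IsCorner D (w M) b) :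
    ∑ P ∈ timedFillings w D (M + 1) with (b, M) ∈ P, β ^ (#P - #D) * ∏ q ∈ P, x q.2 =
      x M * (timedSum β w x (D.erase b) M + β * timedSum β w x D M) := by
  have hnot : ∀ {D' P}, P ∈ timedFillings w D' M → (b, M) ∉ P := fun hP h =>
    absurd ((mem_timedFillings.1 hP).1 _ _ h).2 (by omega)
  have hdisj : Disjoint (timedFillings w (D.erase b) M) (timedFillings w D M) := by
    rw [Finset.disjoint_left]
    intro P h₁ h₂
    obtain ⟨t, ht⟩ := (mem_timedFillings.1 h₂).2.exists_time b hb.mem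
    exact notMem_erase b D ((mem_timedFillings.1 h₁).1 _ _ ht).1
  have hcard : #(D.erase b) + 1 = #D := card_erase_add_one hb.mem
  have step : ∑ P ∈ timedFillings w D (M + 1) with (b, M) ∈ P, β ^ (#P - #D) * ∏ q ∈ P, x q.2 =
      ∑ P ∈ timedFillings w (D.erase b) M ∪ timedFillings w D M,
        β ^ (#P + 1 - #D) * (x M * ∏ q ∈ P, x q.2) := by
    refine sum_nbij' (fun P => P.erase (b, M)) (fun P => insert (b, M) P) ?_ ?_ ?_ ?_ ?_
    · intro P hP
      obtain ⟨hP, hbP⟩ := mem_filter.1 hP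
      obtain ⟨h₁, h₂⟩ := mem_timedFillings.1 hP
      -- the last time is used only in `b`
      have h₁' : ∀ a t, (a, t) ∈ P.erase (b, M) → a ∈ D ∧ t < M := by
        intro a t hat
        obtain ⟨hne, hat'⟩ := mem_erase.1 hat
        obtain ⟨ha, ht⟩ := h₁ _ _ hat'
        refine ⟨ha, lt_of_le_of_ne (by omega) ?_⟩
        rintro rfl
        exact hne (by rw [(isCorner_of_mem_timedFillings hP hat').eq_of_content hb
          (by omega) (by omega)])
      rw [mem_union]
      by_cases hex : ∃ t, (b, t) ∈ P.erase (b, M)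
      · right
        refine mem_timedFillings.2 ⟨h₁', ⟨fun a ha => ?_, fun a t h => h₂.content _ _ (mem_of_mem_erase h),
          fun a s a' t h h' => h₂.lt _ _ _ _ (mem_of_mem_erase h) (mem_of_mem_erase h')⟩⟩
        by_cases hab : a = b
        · exact hab ▸ hex
        · obtain ⟨t, ht⟩ := h₂.exists_time a ha
          exact ⟨t, mem_erase.2 ⟨fun h => hab (congrArg Prod.fst h), ht⟩⟩
      · left
        refine mem_timedFillings.2 ⟨fun a t h => ⟨mem_erase.2 ⟨?_, (h₁' a t h).1⟩, (h₁' a t h).2⟩,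
          ⟨fun a ha => ?_, fun a t h => h₂.content _ _ (mem_of_mem_erase h),
          fun a s a' t h h' => h₂.lt _ _ _ _ (mem_of_mem_erase h) (mem_of_mem_erase h')⟩⟩
        · rintro rfl
          exact hex ⟨t, h⟩
        · obtain ⟨hab, ha⟩ := mem_erase.1 ha
          obtain ⟨t, ht⟩ := h₂.exists_time a ha
          exact ⟨t, mem_erase.2 ⟨fun h => hab (congrArg Prod.fst h), ht⟩⟩
    · intro P hP
      have hP' : (∀ a t, (a, t) ∈ P → a ∈ D ∧ t < M) ∧ (∀ a ∈ D, a ≠ b → ∃ t, (a, t) ∈ P) ∧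
          (∀ a t, (a, t) ∈ P → a.2 - a.1 = w t) ∧
          (∀ a s a' t, (a, s) ∈ P → (a', t) ∈ P → a < a' → s < t) := by
        rcases mem_union.1 hP with h | h <;> obtain ⟨h₁, h₂⟩ := mem_timedFillings.1 h
        · exact ⟨fun a t h => ⟨mem_of_mem_erase (h₁ a t h).1, (h₁ a t h).2⟩,
            fun a ha hab => h₂.exists_time a (mem_erase.2 ⟨hab, ha⟩), h₂.content, h₂.lt⟩
        · exact ⟨h₁, fun a ha _ => h₂.exists_time a ha, h₂.content, h₂.lt⟩
      obtain ⟨h₁, h₂, h₃, h₄⟩ := hP'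
      refine mem_filter.2 ⟨mem_timedFillings.2 ⟨fun a t h => ?_, ⟨fun a ha => ?_, fun a t h => ?_,
        fun a s a' t h h' hlt => ?_⟩⟩, mem_insert_self _ _⟩
      · rcases mem_insert.1 h with h | h
        · obtain ⟨rfl, rfl⟩ := Prod.mk.inj h
          exact ⟨hb.mem, by omega⟩
        · exact ⟨(h₁ a t h).1, (h₁ a t h).2.trans (by omega)⟩
      · by_cases hab : a = b
        · exact ⟨M, hab ▸ mem_insert_self _ _⟩
        · obtain ⟨t, ht⟩ := h₂ a ha hab
          exact ⟨t, mem_insert_of_mem ht⟩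
      · rcases mem_insert.1 h with h | h
        · obtain ⟨rfl, rfl⟩ := Prod.mk.inj h
          exact hb.2
        · exact h₃ a t h
      · rcases mem_insert.1 h with h | h <;> rcases mem_insert.1 h' with h' | h'
        · rw [(Prod.mk.inj h).1, (Prod.mk.inj h').1] at hlt
          exact absurd hlt (lt_irrefl _)
        · rw [(Prod.mk.inj h).1] at hlt
          exact absurd (hb.eq_of_le (h₁ _ _ h').1 hlt.le) hlt.ne'
        · rw [(Prod.mk.inj h').2]
          exact (h₁ _ _ h).2
        · exact h₄ a s a' t h h' hlt
    · intro P hP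
      exact insert_erase (mem_filter.1 hP).2
    · intro P hP
      exact erase_insert (by rcases mem_union.1 hP with h | h <;> exact hnot h)
    · intro P hP
      have hm := (mem_filter.1 hP).2
      rw [card_erase_add_one hm, mul_prod_erase P (fun q => x q.2) hm]
  rw [step, sum_union hdisj, mul_add]
  congr 1
  · rw [timedSum, mul_sum]
    refine sum_congr rfl fun P hP => ?_
    rw [show #P + 1 - #D = #P - #(D.erase b) by omega]
    ring
  · rw [timedSum, mul_sum, mul_sum]
    refine sum_congr rfl fun P hP => ?_
    have := card_le_of_mem_timedFillings hP
    rw [show #P + 1 - #D = #P - #D + 1 by omega]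
    ring

theorem timedSum_succ (β : R) (w : ℕ → ℕ) (x : ℕ → R) {D : Finset (ℤ × ℤ)} (hD : IsShape D)
    (M : ℕ) :
    timedSum β w x D (M + 1) =
      timedSum β w x D M + x M * cornerOp β (w M) (fun D' => timedSum β w x D' M) D := by
  rw [timedSum, ← sum_filter_add_sum_filter_not _ (fun P => ∃ b, (b, M) ∈ P), add_comm]
  congr 1
  · refine sum_congr ?_ fun _ _ => rfl
    ext P
    simp only [mem_filter, mem_timedFillings]
    constructor
    · rintro ⟨⟨h₁, h₂⟩, h₃⟩
      refine ⟨fun b t h => ⟨(h₁ b t h).1, lt_of_le_of_ne (Nat.le_of_lt_succ (h₁ b t h).2) ?_⟩, h₂⟩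
      rintro rfl
      exact h₃ ⟨b, h⟩
    · rintro ⟨h₁, h₂⟩
      refine ⟨⟨fun b t h => ⟨(h₁ b t h).1, (h₁ b t h).2.trans (by omega)⟩, h₂⟩, ?_⟩
      rintro ⟨b, h⟩
      exact absurd (h₁ b M h).2 (by omega)
  · rw [cornerOp_apply _ _ _ hD, mul_sum]
    have : (timedFillings w D (M + 1)).filter (fun P => ∃ b, (b, M) ∈ P) =
        (D.filter (IsCorner D (w M))).biUnion fun b =>
          (timedFillings w D (M + 1)).filter fun P => (b, M) ∈ P := by
      ext P
      simp only [mem_filter, mem_biUnion]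
      constructor
      · rintro ⟨hP, b, hb⟩
        have hc := isCorner_of_mem_timedFillings hP hb
        exact ⟨b, ⟨hc.mem, hc⟩, hP, hb⟩
      · rintro ⟨b, -, hP, hb⟩
        exact ⟨hP, b, hb⟩
    rw [this, sum_biUnion]
    · exact sum_congr rfl fun b hb => sum_timedFillings_of_isCorner β w x M (mem_filter.1 hb).2
    · intro a ha b hb hab
      exact absurd ((mem_filter.1 ha).2.eq_of_content (mem_filter.1 hb).2 (by omega) (by omega)) hab

/-- The generating function of timed fillings as a product of operators, later times on the left. -/
theorem timedSum_eq_prod (β : R) (w : ℕ → ℕ) (x : ℕ → R) (M : ℕ) {D : Finset (ℤ × ℤ)}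
    (hD : IsShape D) :
    timedSum β w x D M =
      (((List.range M).map fun t => 1 + x t • cornerOp β (w t)).reverse.prod)
        (fun D' => if D' = ∅ then 1 else 0) D := by
  induction M generalizing D with
  | zero => simp [timedSum_zero]
  | succ M ih =>
    rw [timedSum_succ β w x hD, List.range_succ, List.map_append, List.reverse_append]
    simp only [List.map_cons, List.map_nil, List.reverse_cons, List.reverse_nil, List.nil_append,
      List.cons_append, List.prod_cons, Module.End.mul_apply, LinearMap.add_apply,
      Module.End.one_apply, LinearMap.smul_apply, Pi.add_apply, Pi.smul_apply, smul_eq_mul]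
    rw [ih hD, cornerOp_congr β (w M) (fun D' hD' => ih hD') hD]

/-! ### Reflection reverses time -/

theorem reflect_reflect (c : ℤ) (p : ℤ × ℤ) :
    SkewShape.reflect c (SkewShape.reflect c p) = p := by
  simp [SkewShape.reflect]

theorem reflect_lt_reflect {c : ℤ} {a b : ℤ × ℤ} (h : a < b) :
    SkewShape.reflect c b < SkewShape.reflect c a := by
  simp only [SkewShape.reflect, Prod.lt_iff] at *
  omega

/-- A reflection preserves contents and reverses the order of boxes, so that times have to be
reversed. -/
theorem reflect_mem_timedFillings (w : ℕ → ℕ) (c : ℤ) {D D' : Finset (ℤ × ℤ)}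
    (hD : ∀ b, b ∈ D' ↔ SkewShape.reflect c b ∈ D) {M : ℕ} {w' : ℕ → ℕ}
    (hw : ∀ t < M, w' t = w (M - 1 - t))
    {P : Finset ((ℤ × ℤ) × ℕ)} (hP : P ∈ timedFillings w D M) :
    P.image (fun q => (SkewShape.reflect c q.1, M - 1 - q.2)) ∈ timedFillings w' D' M := by
  obtain ⟨h₁, h₂⟩ := mem_timedFillings.1 hP
  have key : ∀ b t, (b, t) ∈ P.image (fun q => (SkewShape.reflect c q.1, M - 1 - q.2)) →
      (SkewShape.reflect c b, M - 1 - t) ∈ P ∧ t < M := by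
    intro b t h
    obtain ⟨⟨a, s⟩, hq, he⟩ := mem_image.1 h
    obtain ⟨rfl, rfl⟩ := Prod.mk.inj he
    have := (h₁ _ _ hq).2
    simp only [reflect_reflect]
    rw [show M - 1 - (M - 1 - s) = s by omega]
    exact ⟨hq, by omega⟩
  refine mem_timedFillings.2 ⟨fun b t h => ?_, ⟨fun b hb => ?_, fun b t h => ?_, ?_⟩⟩
  · obtain ⟨h, ht⟩ := key b t h
    exact ⟨(hD b).2 (h₁ _ _ h).1, ht⟩
  · obtain ⟨t, ht⟩ := h₂.exists_time _ ((hD b).1 hb)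
    exact ⟨M - 1 - t, mem_image.2 ⟨_, ht, by simp only [reflect_reflect]⟩⟩
  · obtain ⟨h, ht⟩ := key b t h
    rw [hw t ht, ← h₂.content _ _ h]
    simp [SkewShape.reflect]
  · intro a s b t ha hb hab
    obtain ⟨ha, hs⟩ := key a s ha
    obtain ⟨hb, ht⟩ := key b t hb
    have := h₂.lt _ _ _ _ hb ha (reflect_lt_reflect hab)
    omega

theorem timedSum_reflect (β : R) (w : ℕ → ℕ) (x : ℕ → R) (c : ℤ) (D : Finset (ℤ × ℤ)) (M : ℕ) :
    timedSum β w x (D.image (SkewShape.reflect c)) M =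
      timedSum β (fun t => w (M - 1 - t)) (fun t => x (M - 1 - t)) D M := by
  have hmem : ∀ b, b ∈ D.image (SkewShape.reflect c) ↔ SkewShape.reflect c b ∈ D := by
    intro b
    rw [mem_image]
    constructor
    · rintro ⟨a, ha, rfl⟩
      rwa [reflect_reflect]
    · exact fun h => ⟨_, h, reflect_reflect c b⟩
  have hcard : #(D.image (SkewShape.reflect c)) = #D :=
    card_image_of_injective _ (Function.LeftInverse.injective (reflect_reflect c))
  set ρ : (ℤ × ℤ) × ℕ → (ℤ × ℤ) × ℕ := fun q => (SkewShape.reflect c q.1, M - 1 - q.2) with hρ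
  have hρρ : ∀ {w D P}, P ∈ timedFillings w D M → ∀ q ∈ P, ρ (ρ q) = q := by
    intro w D P hP q hq
    have := ((mem_timedFillings.1 hP).1 q.1 q.2 hq).2
    simp only [hρ, reflect_reflect]
    rw [show M - 1 - (M - 1 - q.2) = q.2 by omega]
  have himage : ∀ {w D P}, P ∈ timedFillings w D M → (P.image ρ).image ρ = P := by
    intro w D P hP
    rw [image_image]
    exact (image_congr (g := id) fun q hq => hρρ hP q hq).trans image_id
  refine sum_nbij' (fun P => P.image ρ) (fun P => P.image ρ) ?_ ?_ ?_ ?_ ?_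
  · exact fun P hP => reflect_mem_timedFillings w c (fun b => by rw [hmem, reflect_reflect])
      (fun t ht => rfl) hP
  · exact fun P hP => reflect_mem_timedFillings _ c hmem
      (fun t ht => by rw [show M - 1 - (M - 1 - t) = t by omega]) hP
  · exact fun P hP => himage hP
  · exact fun P hP => himage hP
  · intro P hP
    have hinj : Set.InjOn ρ P := fun q hq q' hq' h => by
      rw [← hρρ hP q hq, h, hρρ hP q' hq']
    rw [card_image_of_injOn hinj, hcard, prod_image hinj]
    congr 1
    refine prod_congr rfl fun q hq => ?_
    have := ((mem_timedFillings.1 hP).1 q.1 q.2 hq).2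
    simp only [hρ]
    rw [show M - 1 - (M - 1 - q.2) = q.2 by omega]

/-! ### The schedule of contents of a tableau -/

/-- The content allowed at the time `t`. The block of times `l (N + 1) ≤ t < (l + 1) (N + 1)` belongs
to the letter `l + 1` of the encoding of primed and unprimed numbers; it runs down through the
contents `N, …, 0` if that letter is primed, and up if it is unprimed. -/
def schedule (N t : ℕ) : ℕ :=
  if Even (t / (N + 1)) then N - t % (N + 1) else t % (N + 1)

/-- The weight of the time `t`, where `y i` is the weight of the numbers `i + 1` and `(i + 1)'`, except
that primed numbers on the main diagonal have weight `y₀ i`. -/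
def scheduleWeight (N : ℕ) (y y₀ : ℕ → R) (t : ℕ) : R :=
  if Even (t / (N + 1)) ∧ t % (N + 1) = N then y₀ (t / (N + 1) / 2) else y (t / (N + 1) / 2)

theorem reverse_range (n : ℕ) :
    (List.range n).reverse = (List.range n).map fun i => n - 1 - i := by
  refine List.ext_getElem (by simp) fun i h₁ h₂ => ?_
  simp

theorem prod_reverse_mul_prod_eq_palindrome {A : Type*} [Ring A] [Algebra R A] (u : ℕ → A)
    (p x : R) (g g' : ℕ → A) (h₀ : g' 0 * g 0 = 1 + p • u 0)
    (h : ∀ c, g (c + 1) = 1 + x • u (c + 1)) (h' : ∀ c, g' (c + 1) = 1 + x • u (c + 1)) (N : ℕ) :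
    ((List.range (N + 1)).map g').reverse.prod * ((List.range (N + 1)).map g).prod =
      palindrome u p x N := by
  induction N with
  | zero => simp [palindrome, h₀]
  | succ N ih =>
    rw [List.range_succ, List.map_append, List.map_append, List.reverse_append]
    simp only [List.map_cons, List.map_nil, List.reverse_cons, List.reverse_nil, List.nil_append,
      List.cons_append, List.prod_cons, List.prod_append, List.prod_nil, mul_one]
    rw [palindrome, ← ih, h, h']
    noncomm_ring

/-- The times of the two letters `i'` and `i` contribute a palindromic product. -/
theorem block_prod {A : Type*} [Ring A] [Algebra R A] (u : ℕ → A) {β : R}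
    (hsq : u 0 * u 0 = β • u 0) (N : ℕ) (y y₀ : ℕ → R) (i : ℕ) :
    let L := (List.range (2 * (N + 1))).map fun r =>
      1 + scheduleWeight N y y₀ (i * (2 * (N + 1)) + r) • u (schedule N (i * (2 * (N + 1)) + r))
    L.prod = palindrome u (y i + y₀ i + β * y i * y₀ i) (y i) N ∧
      L.reverse.prod = palindrome u (y i + y₀ i + β * y i * y₀ i) (y i) N := by
  intro L
  set g : ℕ → A := fun c => 1 + y i • u c with hg
  set g' : ℕ → A := fun c => 1 + (if c = 0 then y₀ i else y i) • u c with hg'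
  have hL : L = ((List.range (N + 1)).map g').reverse ++ (List.range (N + 1)).map g := by
    simp only [L]
    rw [two_mul, List.range_add, List.map_append]
    congr 1
    · rw [← List.map_reverse, reverse_range, List.map_map]
      refine List.map_congr_left fun r hr => ?_
      have hr := List.mem_range.1 hr
      have e : i * (N + 1 + (N + 1)) + r = r + (N + 1) * (2 * i) := by ring
      have e₁ : (i * (N + 1 + (N + 1)) + r) / (N + 1) = 2 * i := by
        rw [e, Nat.add_mul_div_left _ _ (by omega), Nat.div_eq_of_lt hr, zero_add]
      have e₂ : (i * (N + 1 + (N + 1)) + r) % (N + 1) = r := by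
        rw [e, Nat.add_mul_mod_self_left, Nat.mod_eq_of_lt hr]
      simp only [scheduleWeight, schedule, e₁, e₂, even_two_mul, true_and, if_true, hg',
        Function.comp]
      rw [show 2 * i / 2 = i by omega, show N + 1 - 1 - r = N - r by omega]
      by_cases hrN : r = N
      · simp [hrN]
      · rw [if_neg hrN, if_neg (show ¬ N - r = 0 by omega)]
    · rw [List.map_map]
      refine List.map_congr_left fun r hr => ?_
      have hr := List.mem_range.1 hr
      have e : i * (N + 1 + (N + 1)) + (N + 1 + r) = r + (N + 1) * (2 * i + 1) := by ring
      have e₁ : (i * (N + 1 + (N + 1)) + (N + 1 + r)) / (N + 1) = 2 * i + 1 := by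
        rw [e, Nat.add_mul_div_left _ _ (by omega), Nat.div_eq_of_lt hr, zero_add]
      have e₂ : (i * (N + 1 + (N + 1)) + (N + 1 + r)) % (N + 1) = r := by
        rw [e, Nat.add_mul_mod_self_left, Nat.mod_eq_of_lt hr]
      have e₃ : ¬ Even (2 * i + 1) := by simp
      simp only [scheduleWeight, schedule, Function.comp, e₁, e₂, e₃, false_and, if_false, hg]
      rw [show (2 * i + 1) / 2 = i by omega]
  have h₀ : g' 0 * g 0 = 1 + (y i + y₀ i + β * y i * y₀ i) • u 0 := by
    simp only [hg, hg', if_true]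
    rw [one_add_smul_mul hsq]
    congr 2
    ring
  have h₁ : g 0 * g' 0 = 1 + (y i + y₀ i + β * y i * y₀ i) • u 0 := by
    simp only [hg, hg', if_true]
    rw [one_add_smul_mul hsq]
  have hs : ∀ c, g (c + 1) = 1 + y i • u (c + 1) := fun c => rfl
  have hs' : ∀ c, g' (c + 1) = 1 + y i • u (c + 1) := fun c => by simp [hg']
  rw [hL]
  constructor
  · rw [List.prod_append]
    exact prod_reverse_mul_prod_eq_palindrome u _ _ g g' h₀ hs hs' N
  · rw [List.reverse_append, List.reverse_reverse, List.prod_append]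
    exact prod_reverse_mul_prod_eq_palindrome u _ _ g' g h₁ hs' hs N

/-- If the palindromic products commute, then the whole product of operators is unchanged when it
is reversed. -/
theorem schedule_prod_reverse {A : Type*} [Ring A] [Algebra R A] (u : ℕ → A) {β : R}
    (hsq : u 0 * u 0 = β • u 0) (N : ℕ) (y y₀ : ℕ → R)
    (hcomm : ∀ i j, Commute (palindrome u (y i + y₀ i + β * y i * y₀ i) (y i) N)
      (palindrome u (y j + y₀ j + β * y j * y₀ j) (y j) N)) (n : ℕ) :
    let L := (List.range (n * (2 * (N + 1)))).map fun t =>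
      1 + scheduleWeight N y y₀ t • u (schedule N t)
    L.reverse.prod = L.prod := by
  suffices h : let L := (List.range (n * (2 * (N + 1)))).map fun t =>
      1 + scheduleWeight N y y₀ t • u (schedule N t)
      L.reverse.prod = L.prod ∧
      ∀ j, Commute L.prod (palindrome u (y j + y₀ j + β * y j * y₀ j) (y j) N) from h.1
  induction n with
  | zero => simp
  | succ n ih =>
    obtain ⟨h₁, h₂⟩ := ih
    obtain ⟨b₁, b₂⟩ := block_prod u hsq N y y₀ n
    rw [add_mul, one_mul, List.range_add, List.map_append, List.map_map]
    simp only [Function.comp_def, List.reverse_append, List.prod_append]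
    rw [b₁, b₂, h₁]
    exact ⟨(h₂ n).eq.symm, fun j => (h₂ j).mul_left (hcomm n j)⟩

/-- The timed generating function does not change under reflection. -/
theorem timedSum_schedule_reflect {β : R} (N n : ℕ) (y y₀ : ℕ → R)
    (hcomm : ∀ i j, Commute
      (palindrome (cornerOp β) (y i + y₀ i + β * y i * y₀ i) (y i) N)
      (palindrome (cornerOp β) (y j + y₀ j + β * y j * y₀ j) (y j) N))
    {D : Finset (ℤ × ℤ)} (hD : IsShape D) (c : ℤ) :
    timedSum β (schedule N) (scheduleWeight N y y₀) (D.image (SkewShape.reflect c))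
        (n * (2 * (N + 1))) =
      timedSum β (schedule N) (scheduleWeight N y y₀) D (n * (2 * (N + 1))) := by
  rw [timedSum_reflect, timedSum_eq_prod _ _ _ _ hD, timedSum_eq_prod _ _ _ _ hD,
    schedule_prod_reverse (cornerOp β) (cornerOp_mul_self β 0) N y y₀ hcomm n]
  rw [← List.map_reverse, reverse_range, List.map_map]
  refine congrArg (fun l : List (Module.End R (Finset (ℤ × ℤ) → R)) => l.prod _ D)
    (List.map_congr_left fun t ht => ?_)
  have ht := List.mem_range.1 ht
  simp only [Function.comp]
  rw [show n * (2 * (N + 1)) - 1 - (n * (2 * (N + 1)) - 1 - t) = t by omega]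

/-! ### Tableaux as timed fillings -/

/-- The content of a box, as a natural number. It is the genuine content if the box is on or above
the main diagonal. -/
def content (b : ℤ × ℤ) : ℕ := (b.2 - b.1).toNat

/-- The time in the block of the letter `k` at which `schedule N` allows the content `c ≤ N`. -/
def letterTime (N : ℕ) (k : ℕ+) (c : ℕ) : ℕ :=
  ((k : ℕ) - 1) * (N + 1) + if IsPrimed k then N - c else c

section letterTime

variable {N : ℕ} {k l : ℕ+} {c d : ℕ}

theorem letterTime_div (hc : c ≤ N) : letterTime N k c / (N + 1) = k - 1 := by
  have : (if IsPrimed k then N - c else c) < N + 1 := by split_ifs <;> omega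
  rw [letterTime, mul_comm, Nat.mul_add_div (by omega), Nat.div_eq_of_lt this, add_zero]

theorem letterTime_mod (hc : c ≤ N) :
    letterTime N k c % (N + 1) = if IsPrimed k then N - c else c := by
  have : (if IsPrimed k then N - c else c) < N + 1 := by split_ifs <;> omega
  rw [letterTime, mul_comm, Nat.mul_add_mod, Nat.mod_eq_of_lt this]

theorem even_sub_one_iff : Even ((k : ℕ) - 1) ↔ IsPrimed k := by
  have := k.pos
  rw [IsPrimed, Nat.even_iff, Nat.odd_iff]
  omega

theorem schedule_letterTime (hc : c ≤ N) : schedule N (letterTime N k c) = c := by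
  simp only [schedule, letterTime_div hc, letterTime_mod hc, even_sub_one_iff]
  split_ifs <;> omega

theorem letterTime_schedule (t : ℕ) : letterTime N (t / (N + 1)).succPNat (schedule N t) = t := by
  have h := Nat.div_add_mod t (N + 1)
  have hlt : t % (N + 1) < N + 1 := Nat.mod_lt _ (by omega)
  simp only [letterTime, schedule, ← even_sub_one_iff, Nat.succPNat_coe, Nat.succ_eq_add_one,
    Nat.add_sub_cancel, mul_comm _ (N + 1)]
  split_ifs <;> omega

theorem letterTime_lt_of_lt (hc : c ≤ N) (hd : d ≤ N) (h : k < l) :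
    letterTime N k c < letterTime N l d := by
  have h : (k : ℕ) < l := h
  have := k.pos
  refine Nat.lt_of_div_lt_div (c := N + 1) ?_
  rw [letterTime_div hc, letterTime_div hd]
  omega

theorem letterTime_injective (hc : c ≤ N) (hd : d ≤ N) (h : letterTime N k c = letterTime N l d) :
    k = l := by
  rcases lt_trichotomy k l with hlt | rfl | hlt
  · exact absurd h (letterTime_lt_of_lt hc hd hlt).ne
  · rfl
  · exact absurd h (letterTime_lt_of_lt hd hc hlt).ne'

theorem letterTime_lt_iff_of_primed (hk : IsPrimed k) (hc : c ≤ N) (hd : d ≤ N) :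
    letterTime N k c < letterTime N k d ↔ d < c := by
  simp only [letterTime, if_pos hk]
  omega

theorem letterTime_lt_iff_of_not_primed (hk : ¬ IsPrimed k) :
    letterTime N k c < letterTime N k d ↔ c < d := by
  simp only [letterTime, if_neg hk]
  omega

theorem letterTime_lt_mul_iff (hc : c ≤ N) (n : ℕ) :
    letterTime N k c < n * (2 * (N + 1)) ↔ k ≤ 2 * n := by
  have := k.pos
  rw [show n * (2 * (N + 1)) = (2 * n) * (N + 1) by ring, ← Nat.div_lt_iff_lt_mul (by omega),
    letterTime_div hc]
  omega

end letterTime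

variable {S : SkewShape} {N : ℕ}

/-- The timed filling of a tableau: a letter `k` in a box `b` becomes the time of `k` at the content
of `b`. -/
def timesOf (N : ℕ) (T : SetFilling S) : Finset ((ℤ × ℤ) × ℕ) :=
  univ.biUnion fun b => (T b).image fun k => (b.1, letterTime N k (content b.1))

/-- The tableau of a timed filling. -/
def lettersOf (S : SkewShape) (N : ℕ) (P : Finset ((ℤ × ℤ) × ℕ)) : SetFilling S :=
  fun b => (P.filter fun q => q.1 = b.1).image fun q => (q.2 / (N + 1)).succPNat

theorem mem_timesOf {T : SetFilling S} {b : ℤ × ℤ} {t : ℕ} :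
    (b, t) ∈ timesOf N T ↔ ∃ h : b ∈ S.SD, ∃ k ∈ T ⟨b, h⟩, letterTime N k (content b) = t := by
  simp only [timesOf, mem_biUnion, mem_univ, true_and, mem_image, Prod.mk.injEq]
  constructor
  · rintro ⟨⟨a, ha⟩, k, hk, rfl, rfl⟩
    exact ⟨ha, k, hk, rfl⟩
  · rintro ⟨h, k, hk, rfl⟩
    exact ⟨⟨b, h⟩, k, hk, rfl, rfl⟩

theorem letterTime_mem_timesOf {T : SetFilling S} (hN : ∀ b ∈ S.SD, content b ≤ N)
    {b : {b : ℤ × ℤ // b ∈ S.SD}} {k : ℕ+} :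
    (b.1, letterTime N k (content b.1)) ∈ timesOf N T ↔ k ∈ T b := by
  rw [mem_timesOf]
  constructor
  · rintro ⟨h, l, hl, e⟩
    rwa [← letterTime_injective (hN _ h) (hN _ h) e]
  · exact fun h => ⟨b.2, k, h, rfl⟩

theorem sum_timesOf {M : Type*} [AddCommMonoid M] (hN : ∀ b ∈ S.SD, content b ≤ N)
    (T : SetFilling S) (f : (ℤ × ℤ) × ℕ → M) :
    ∑ q ∈ timesOf N T, f q = ∑ b, ∑ k ∈ T b, f (b.1, letterTime N k (content b.1)) := by
  rw [timesOf, sum_biUnion]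
  · refine sum_congr rfl fun b _ => sum_image fun k _ l _ h => ?_
    exact letterTime_injective (hN _ b.2) (hN _ b.2) (congrArg Prod.snd h)
  · intro a _ b _ hab
    rw [Function.onFun, Finset.disjoint_left]
    intro q hq hq'
    obtain ⟨k, -, rfl⟩ := mem_image.1 hq
    obtain ⟨l, -, h⟩ := mem_image.1 hq'
    exact hab (Subtype.ext (congrArg Prod.fst h).symm)

theorem card_timesOf (hN : ∀ b ∈ S.SD, content b ≤ N) (T : SetFilling S) :
    #(timesOf N T) = T.size := by
  rw [card_eq_sum_ones, sum_timesOf hN, SetFilling.size]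
  simp

/-- The exponent vector of a set of (box, time) pairs. -/
def timedWeight (N : ℕ) (P : Finset ((ℤ × ℤ) × ℕ)) : ℕ+ →₀ ℕ :=
  ∑ q ∈ P, Finsupp.single (q.2 / (N + 1) / 2).succPNat 1

theorem letterIndex_eq (k : ℕ+) : letterIndex k = (((k : ℕ) - 1) / 2).succPNat := by
  have := k.pos
  apply PNat.eq
  simp only [letterIndex, PNat.mk_coe, Nat.succPNat_coe, Nat.succ_eq_add_one]
  omega

theorem timedWeight_timesOf (hN : ∀ b ∈ S.SD, content b ≤ N) (T : SetFilling S) :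
    timedWeight N (timesOf N T) = T.weight := by
  rw [timedWeight, sum_timesOf hN, SetFilling.weight]
  refine sum_congr rfl fun b _ => sum_congr rfl fun k _ => ?_
  rw [letterTime_div (hN _ b.2), letterIndex_eq]

theorem letterIndex_mem_support_weight {T : SetFilling S} {b : {b : ℤ × ℤ // b ∈ S.SD}} {k : ℕ+}
    (hk : k ∈ T b) : letterIndex k ∈ T.weight.support := by
  have h : Finsupp.single (letterIndex k) 1 ≤ T.weight :=
    (single_le_sum (f := fun k => (Finsupp.single (letterIndex k) 1 : ℕ+ →₀ ℕ))
      (fun _ _ => zero_le) hk).trans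
    (single_le_sum (f := fun b => ∑ k ∈ T b, (Finsupp.single (letterIndex k) 1 : ℕ+ →₀ ℕ))
      (fun _ _ => zero_le) (mem_univ b))
  have := h (letterIndex k)
  rw [Finsupp.single_eq_same] at this
  exact Finsupp.mem_support_iff.2 (by omega)

/-- The semistandardness conditions say exactly that times increase strictly along the componentwise
order: equal unprimed numbers may occur along a row, in which the content increases, and equal primed
numbers along a column, in which it decreases. -/
theorem timesOf_mem_timedFillings (hS : IsShape S.SD) (hN : ∀ b ∈ S.SD, content b ≤ N) {n : ℕ}
    {T : SetFilling S} (hT : IsSemistandard T) (hn : ∀ b, ∀ k ∈ T b, (k : ℕ) ≤ 2 * n) :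
    timesOf N T ∈ timedFillings (schedule N) S.SD (n * (2 * (N + 1))) := by
  refine mem_timedFillings.2 ⟨fun b t h => ?_, ⟨fun b hb => ?_, fun b t h => ?_, ?_⟩⟩
  · obtain ⟨hb, k, hk, rfl⟩ := mem_timesOf.1 h
    exact ⟨hb, (letterTime_lt_mul_iff (hN b hb) n).2 (hn _ k hk)⟩
  · obtain ⟨k, hk⟩ := hT.nonempty ⟨b, hb⟩
    exact ⟨_, mem_timesOf.2 ⟨hb, k, hk, rfl⟩⟩
  · obtain ⟨hb, k, hk, rfl⟩ := mem_timesOf.1 h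
    have := hS.le b hb
    rw [schedule_letterTime (hN b hb), content]
    omega
  · intro a s b t hs ht hab
    obtain ⟨ha, k, hk, rfl⟩ := mem_timesOf.1 hs
    obtain ⟨hb, l, hl, rfl⟩ := mem_timesOf.1 ht
    clear hs ht
    have ha' := hS.le a ha
    have hb' := hS.le b hb
    obtain ⟨h₁, h₂⟩ := Prod.le_def.1 hab.le
    suffices h : k ≤ l ∧ (k = l → letterTime N k (content a) < letterTime N k (content b)) by
      rcases h.1.lt_or_eq with hkl | rfl
      · exact letterTime_lt_of_lt (hN a ha) (hN b hb) hkl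
      · exact h.2 rfl
    rcases h₁.lt_or_eq with h₁ | h₁ <;> rcases h₂.lt_or_eq with h₂ | h₂
    · -- compare both boxes with the one at the corner of the hook joining them
      have hp : (a.1, b.2) ∈ S.SD := by
        refine hS.convex a ha b hb _ ?_ ?_ ?_ <;> simp only [Prod.le_def] <;> omega
      obtain ⟨r, hr⟩ := hT.nonempty ⟨_, hp⟩
      have hkr := hT.row_le ⟨a, ha⟩ ⟨_, hp⟩ rfl h₂ k hk r hr
      have hrl := hT.col_le ⟨_, hp⟩ ⟨b, hb⟩ rfl h₁ r hr l hl
      refine ⟨hkr.trans hrl, ?_⟩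
      rintro rfl
      obtain rfl := le_antisymm hkr hrl
      exfalso
      by_cases hkp : IsPrimed k
      · have := congrArg (fun b => b.1.2) (hT.row_primed ⟨a, ha⟩ ⟨_, hp⟩ rfl k hkp hk hr)
        exact h₂.ne this
      · have := congrArg (fun b => b.1.1) (hT.col_unprimed ⟨_, hp⟩ ⟨b, hb⟩ rfl k hkp hr hl)
        exact h₁.ne this
    · refine ⟨hT.col_le ⟨a, ha⟩ ⟨b, hb⟩ h₂ h₁ k hk l hl, ?_⟩
      rintro rfl
      have hkp : IsPrimed k := by
        by_contra hkp
        have := congrArg (fun b => b.1.1) (hT.col_unprimed ⟨a, ha⟩ ⟨b, hb⟩ h₂ k hkp hk hl)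
        exact h₁.ne this
      rw [letterTime_lt_iff_of_primed hkp (hN a ha) (hN b hb), content, content]
      omega
    · refine ⟨hT.row_le ⟨a, ha⟩ ⟨b, hb⟩ h₁ h₂ k hk l hl, ?_⟩
      rintro rfl
      have hkp : ¬ IsPrimed k := by
        intro hkp
        have := congrArg (fun b => b.1.2) (hT.row_primed ⟨a, ha⟩ ⟨b, hb⟩ h₁ k hkp hk hl)
        exact h₂.ne this
      rw [letterTime_lt_iff_of_not_primed hkp, content, content]
      omega
    · exact absurd (Prod.ext h₁ h₂) hab.ne

theorem mem_lettersOf {M : ℕ} {P : Finset ((ℤ × ℤ) × ℕ)}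
    (hP : P ∈ timedFillings (schedule N) S.SD M) (hN : ∀ b ∈ S.SD, content b ≤ N)
    {b : {b : ℤ × ℤ // b ∈ S.SD}} {k : ℕ+} :
    k ∈ lettersOf S N P b ↔ (b.1, letterTime N k (content b.1)) ∈ P := by
  simp only [lettersOf, mem_image, mem_filter]
  constructor
  · rintro ⟨⟨a, t⟩, ⟨h, rfl⟩, rfl⟩
    have hc := (mem_timedFillings.1 hP).2.content _ _ h
    rw [content, hc, Int.toNat_natCast, letterTime_schedule]
    exact h
  · intro h
    refine ⟨_, ⟨h, rfl⟩, ?_⟩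
    rw [letterTime_div (hN _ b.2)]
    exact PNat.eq (by simp [Nat.sub_add_cancel k.pos])

theorem timesOf_lettersOf {M : ℕ} {P : Finset ((ℤ × ℤ) × ℕ)}
    (hP : P ∈ timedFillings (schedule N) S.SD M) (hN : ∀ b ∈ S.SD, content b ≤ N) :
    timesOf N (lettersOf S N P) = P := by
  ext ⟨b, t⟩
  rw [mem_timesOf]
  constructor
  · rintro ⟨hb, k, hk, rfl⟩
    exact (mem_lettersOf hP hN).1 hk
  · intro h
    have hb := ((mem_timedFillings.1 hP).1 b t h).1
    have hc := (mem_timedFillings.1 hP).2.content _ _ h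
    have e : letterTime N (t / (N + 1)).succPNat (content b) = t := by
      rw [content, hc, Int.toNat_natCast, letterTime_schedule]
    exact ⟨hb, _, (mem_lettersOf hP hN).2 (e.symm ▸ h), e⟩

theorem lettersOf_timesOf (hN : ∀ b ∈ S.SD, content b ≤ N) {M : ℕ}
    {T : SetFilling S} (hT : timesOf N T ∈ timedFillings (schedule N) S.SD M) :
    lettersOf S N (timesOf N T) = T := by
  ext b k
  rw [mem_lettersOf hT hN, letterTime_mem_timesOf hN]

theorem isSemistandard_lettersOf {M : ℕ} {P : Finset ((ℤ × ℤ) × ℕ)}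
    (hP : P ∈ timedFillings (schedule N) S.SD M) (hN : ∀ b ∈ S.SD, content b ≤ N) :
    IsSemistandard (lettersOf S N P) := by
  have hmem := fun b k => mem_lettersOf hP hN (b := b) (k := k)
  have hlt : ∀ a b : {b : ℤ × ℤ // b ∈ S.SD}, a.1 < b.1 → ∀ k ∈ lettersOf S N P a,
      ∀ l ∈ lettersOf S N P b, letterTime N k (content a.1) < letterTime N l (content b.1) :=
    fun a b hab k hk l hl => (mem_timedFillings.1 hP).2.lt _ _ _ _ ((hmem _ _).1 hk)
      ((hmem _ _).1 hl) hab
  have hle : ∀ a b : {b : ℤ × ℤ // b ∈ S.SD}, a.1 < b.1 → ∀ k ∈ lettersOf S N P a,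
      ∀ l ∈ lettersOf S N P b, k ≤ l := fun a b hab k hk l hl => not_lt.1 fun h =>
    (hlt a b hab k hk l hl).not_gt (letterTime_lt_of_lt (hN _ b.2) (hN _ a.2) h)
  refine ⟨fun b => ?_, fun a b h h' => hle a b ?_, fun a b h h' => hle a b ?_, ?_, ?_⟩
  · obtain ⟨t, ht⟩ := (mem_timedFillings.1 hP).2.exists_time _ b.2
    exact ⟨_, mem_image.2 ⟨_, mem_filter.2 ⟨ht, rfl⟩, rfl⟩⟩
  · exact Prod.lt_iff.2 (Or.inr ⟨h.le, h'⟩)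
  · exact Prod.lt_iff.2 (Or.inl ⟨h', h.le⟩)
  · have aux : ∀ a b : {b : ℤ × ℤ // b ∈ S.SD}, a.1.2 = b.1.2 → ∀ k, ¬ IsPrimed k →
        k ∈ lettersOf S N P a → k ∈ lettersOf S N P b → ¬ a.1.1 < b.1.1 := by
      intro a b h k hk hka hkb hlt'
      have := hlt a b (Prod.lt_iff.2 (Or.inl ⟨hlt', h.le⟩)) k hka k hkb
      rw [letterTime_lt_iff_of_not_primed hk, content, content] at this
      omega
    intro a b h k hk hka hkb
    refine Subtype.ext (Prod.ext ?_ h)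
    have h₁ := aux a b h k hk hka hkb
    have h₂ := aux b a h.symm k hk hkb hka
    omega
  · have aux : ∀ a b : {b : ℤ × ℤ // b ∈ S.SD}, a.1.1 = b.1.1 → ∀ k, IsPrimed k →
        k ∈ lettersOf S N P a → k ∈ lettersOf S N P b → ¬ a.1.2 < b.1.2 := by
      intro a b h k hk hka hkb hlt'
      have := hlt a b (Prod.lt_iff.2 (Or.inr ⟨h.le, hlt'⟩)) k hka k hkb
      rw [letterTime_lt_iff_of_primed hk (hN _ a.2) (hN _ b.2), content, content] at this
      omega
    intro a b h k hk hka hkb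
    refine Subtype.ext (Prod.ext h ?_)
    have h₁ := aux a b h k hk hka hkb
    have h₂ := aux b a h.symm k hk hkb hka
    omega

/-! ### Generating functions of tableaux -/

/-- The variable `β`, as a constant power series. -/
def betaSeries : MvPowerSeries ℕ+ (Polynomial ℤ) := MvPowerSeries.C Polynomial.X

/-- The variable `x_{i+1}`. -/
def letterWeight (i : ℕ) : MvPowerSeries ℕ+ (Polynomial ℤ) := MvPowerSeries.X i.succPNat

/-- Semistandard tableaux; if `diag` holds, primed numbers are excluded from the diagonal. -/
def tableaux (diag : Prop) (S : SkewShape) : Set (SetFilling S) :=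
  {T | IsSemistandard T ∧ (diag → ∀ b, b.1.1 = b.1.2 → ∀ k ∈ T b, ¬ IsPrimed k)}

/-- The weight of primed numbers on the main diagonal. -/
def diagWeight (diag : Prop) (i : ℕ) : MvPowerSeries ℕ+ (Polynomial ℤ) :=
  if diag then 0 else letterWeight i

/-- No primed number is used in a diagonal box. -/
def DiagFree (N : ℕ) (P : Finset ((ℤ × ℤ) × ℕ)) : Prop :=
  ∀ q ∈ P, ¬ (Even (q.2 / (N + 1)) ∧ q.2 % (N + 1) = N)

theorem coeff_timedSum_term (diag : Prop) (N e : ℕ) (P : Finset ((ℤ × ℤ) × ℕ)) (m : ℕ+ →₀ ℕ) :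
    MvPowerSeries.coeff m
      (betaSeries ^ e * ∏ q ∈ P, scheduleWeight N letterWeight (diagWeight diag) q.2) =
      if (diag → DiagFree N P) ∧ timedWeight N P = m then (Polynomial.X : Polynomial ℤ) ^ e
      else 0 := by
  by_cases h : diag → DiagFree N P
  · have : ∏ q ∈ P, scheduleWeight N letterWeight (diagWeight diag) q.2 =
        MvPowerSeries.monomial (timedWeight N P) 1 := by
      have e₁ : ∀ q ∈ P, scheduleWeight N letterWeight (diagWeight diag) q.2 =
          MvPowerSeries.monomial (Finsupp.single (q.2 / (N + 1) / 2).succPNat 1) 1 := by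
        intro q hq
        rw [scheduleWeight, diagWeight, letterWeight, MvPowerSeries.X]
        split_ifs with h₁ h₂
        · exact absurd h₁ (h h₂ q hq)
        · rfl
        · rfl
      rw [prod_congr rfl e₁, MvPowerSeries.prod_monomial]
      simp [timedWeight]
    rw [this, betaSeries, ← map_pow, MvPowerSeries.coeff_C_mul, MvPowerSeries.coeff_monomial]
    by_cases hm : timedWeight N P = m
    · rw [if_pos hm.symm, if_pos ⟨h, hm⟩, mul_one]
    · simp [hm, Ne.symm hm]
  · rw [if_neg fun h' => h h'.1]
    push Not at h
    obtain ⟨hd, hP⟩ := h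
    rw [DiagFree] at hP
    push Not at hP
    obtain ⟨q, hq, hq'⟩ := hP
    have : ∏ q ∈ P, scheduleWeight N letterWeight (diagWeight diag) q.2 = 0 :=
      prod_eq_zero hq (by rw [scheduleWeight, if_pos hq', diagWeight, if_pos hd])
    rw [this, mul_zero, map_zero]

theorem diagFree_timesOf_iff (hS : IsShape S.SD) (hN : ∀ b ∈ S.SD, content b ≤ N)
    (T : SetFilling S) :
    DiagFree N (timesOf N T) ↔ ∀ b, b.1.1 = b.1.2 → ∀ k ∈ T b, ¬ IsPrimed k := by
  have key : ∀ b : {b : ℤ × ℤ // b ∈ S.SD}, ∀ k : ℕ+,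
      (Even (letterTime N k (content b.1) / (N + 1)) ∧
        letterTime N k (content b.1) % (N + 1) = N) ↔ IsPrimed k ∧ (b.1.1 = b.1.2 ∨
          ¬ IsPrimed k) := by
    intro b k
    have h₁ := hS.le _ b.2
    have h₂ := hN _ b.2
    rw [letterTime_div h₂, letterTime_mod h₂, even_sub_one_iff]
    refine and_congr_right fun hk => ?_
    rw [if_pos hk]
    simp only [hk, not_true_eq_false, or_false]
    rw [content] at *
    omega
  constructor
  · intro h b hb k hk hkp
    exact h _ ((letterTime_mem_timesOf hN).2 hk) ((key b k).2 ⟨hkp, Or.inl hb⟩)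
  · rintro h ⟨b, t⟩ hq hq'
    obtain ⟨hb, k, hk, rfl⟩ := mem_timesOf.1 hq
    obtain ⟨hkp, h'⟩ := (key ⟨b, hb⟩ k).1 hq'
    exact h ⟨b, hb⟩ (h'.resolve_right (not_not.2 hkp)) k hk hkp

/-- A coefficient of the generating function of tableaux can be computed with timed fillings that
only involve finitely many letters. -/
theorem coeff_tableauGenFun (diag : Prop) (hS : IsShape S.SD) (hN : ∀ b ∈ S.SD, content b ≤ N)
    {m : ℕ+ →₀ ℕ} {n : ℕ} (hm : ∀ i ∈ m.support, (i : ℕ) ≤ n) :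
    MvPowerSeries.coeff m (tableauGenFun (tableaux diag S)) =
      MvPowerSeries.coeff m (timedSum betaSeries (schedule N)
        (scheduleWeight N letterWeight (diagWeight diag)) S.SD (n * (2 * (N + 1)))) := by
  rw [timedSum, map_sum]
  simp only [coeff_timedSum_term]
  rw [← sum_filter]
  have hmem : ∀ T : SetFilling S, T ∈ tableaux diag S → T.weight = m →
      timesOf N T ∈ timedFillings (schedule N) S.SD (n * (2 * (N + 1))) := by
    rintro T hT rfl
    refine timesOf_mem_timedFillings hS hN hT.1 fun b k hk => ?_
    have := hm _ (letterIndex_mem_support_weight hk)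
    simp only [letterIndex, PNat.mk_coe] at this
    omega
  change ∑ T ∈ _, _ = _
  refine sum_nbij' (fun T => timesOf N T) (fun P => lettersOf S N P) ?_ ?_ ?_ ?_ ?_
  · intro T hT
    obtain ⟨hT, hw⟩ := (Set.Finite.mem_toFinset _).1 hT
    exact mem_filter.2 ⟨hmem T hT hw, fun hd => (diagFree_timesOf_iff hS hN T).2 (hT.2 hd),
      (timedWeight_timesOf hN T).trans hw⟩
  · intro P hP
    obtain ⟨hP, hd, hw⟩ := mem_filter.1 hP
    have e := timesOf_lettersOf hP hN
    refine (Set.Finite.mem_toFinset _).2 ⟨⟨isSemistandard_lettersOf hP hN, fun h => ?_⟩, ?_⟩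
    · rw [← diagFree_timesOf_iff hS hN, e]
      exact hd h
    · rw [← timedWeight_timesOf hN, e, hw]
  · intro T hT
    obtain ⟨hT, hw⟩ := (Set.Finite.mem_toFinset _).1 hT
    exact lettersOf_timesOf hN (hmem T hT hw)
  · intro P hP
    exact timesOf_lettersOf (mem_filter.1 hP).1 hN
  · intro T _
    rw [card_timesOf hN]

theorem commute_palindrome_letterWeight (diag : Prop) (N i j : ℕ) :
    Commute
      (palindrome (cornerOp betaSeries) (letterWeight i + diagWeight diag i +
        betaSeries * letterWeight i * diagWeight diag i) (letterWeight i) N)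
      (palindrome (cornerOp betaSeries) (letterWeight j + diagWeight diag j +
        betaSeries * letterWeight j * diagWeight diag j) (letterWeight j) N) := by
  have hu : IsUnit (1 + betaSeries * letterWeight i) := by
    rw [MvPowerSeries.isUnit_iff_constantCoeff]
    simp [letterWeight]
  obtain ⟨v, hv⟩ := hu.exists_right_inv
  set x := letterWeight i
  set y := letterWeight j
  set β := betaSeries
  -- `z` is the formal difference of `y` and `x`
  obtain ⟨z, hz⟩ : ∃ z, y = z + x + β * z * x :=
    ⟨(y - x) * v, by linear_combination (x - y) * hv⟩
  refine palindrome_commute (β := β) (cornerOp_mul_self β)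
    (fun c d h => cornerOp_commute β h) (fun c hc => cornerOp_mul_mul_eq_zero β (Or.inl ⟨rfl, hc⟩))
    (fun c => cornerOp_mul_mul_eq_zero β (Or.inr rfl)) hz rfl ?_ N
  by_cases hd : diag
  · simp only [diagWeight, if_pos hd]
    rw [hz]
    ring
  · simp only [diagWeight, if_neg hd]
    change (x + x + β * x * x) * _ + (y + y + β * y * y) * _ * _ = _ * (y + y + β * y * y)
    rw [hz]
    ring

theorem tableauGenFun_eq_of_isFlip (diag : Prop) {S S' : SkewShape} (hS : IsShape S.SD)
    (hS' : IsShape S'.SD) (h : SkewShape.IsFlip S S') :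
    tableauGenFun (tableaux diag S') = tableauGenFun (tableaux diag S) := by
  obtain ⟨c, hc⟩ := h
  ext1 m
  obtain ⟨N, hN⟩ : ∃ N, ∀ b ∈ S.SD ∪ S'.SD, content b ≤ N :=
    ⟨(S.SD ∪ S'.SD).sup content, fun b hb => le_sup hb⟩
  obtain ⟨n, hn⟩ : ∃ n : ℕ, ∀ i ∈ m.support, (i : ℕ) ≤ n :=
    ⟨m.support.sup fun i => (i : ℕ), fun i hi => le_sup (f := fun i : ℕ+ => (i : ℕ)) hi⟩
  rw [coeff_tableauGenFun diag hS' (fun b hb => hN b (mem_union_right _ hb)) hn,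
    coeff_tableauGenFun diag hS (fun b hb => hN b (mem_union_left _ hb)) hn, hc,
    timedSum_schedule_reflect N n _ _ (commute_palindrome_letterWeight diag N) hS]

/-! ### Shifted diagrams are the order ideals of the shifted plane -/

theorem add_part_le (lam : StrictPartition) {i i' : ℤ} (hi' : 1 ≤ i') (hii' : i' ≤ i)
    (hpos : 0 < lam.part i) : i + lam.part i ≤ i' + lam.part i' := by
  have hlen : (i - 1).toNat < lam.parts.length := by
    by_contra h
    rw [StrictPartition.part, List.getD_eq_default _ _ (by omega)] at hpos
    exact absurd hpos (lt_irrefl _)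
  induction i, hii' using Int.leInduction with
  | base => exact le_rfl
  | succ k hk ih =>
    have hlt : lam.part (k + 1) < lam.part k := by
      have := List.pairwise_iff_getElem.1 lam.strict (k - 1).toNat (k + 1 - 1).toNat (by omega)
        hlen (by omega)
      rwa [StrictPartition.part, StrictPartition.part, List.getD_eq_getElem _ _ hlen,
        List.getD_eq_getElem _ _ (by omega)]
    have := ih (by omega) (by omega)
    omega

theorem mem_SD_of_le {lam : StrictPartition} {i j i' j' : ℤ} (h : (i, j) ∈ lam.SD) (hi' : 0 < i')
    (hi : i' ≤ i) (hj : j' ≤ j) (hij : i' ≤ j') : (i', j') ∈ lam.SD := by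
  rw [StrictPartition.mem_SD] at *
  have := add_part_le lam (i' := i') (i := i) (by omega) hi (by omega)
  omega

theorem isShape_SD (S : SkewShape) : IsShape S.SD where
  le b hb := by
    have := (StrictPartition.mem_SD _ _ _).1 (mem_sdiff.1 hb).1
    exact this.2.1
  convex a ha b hb p hap hpb hp := by
    obtain ⟨ha, ha'⟩ := mem_sdiff.1 ha
    obtain ⟨hb, -⟩ := mem_sdiff.1 hb
    have h := (StrictPartition.mem_SD _ _ _).1 ha
    obtain ⟨h₁, h₂⟩ := Prod.le_def.1 hap
    exact mem_sdiff.2 ⟨mem_SD_of_le hb (by omega) hpb.1 hpb.2 hp,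
      fun h' => ha' (mem_SD_of_le h' h.1 h₁ h₂ h.2.1)⟩

theorem subset_of_SD_subset {mu lam : StrictPartition} (h : mu.SD ⊆ lam.SD) : mu ⊆ lam := by
  intro i hi
  rcases Nat.eq_zero_or_pos (mu.part i) with h0 | h0
  · omega
  · have : (i, i + mu.part i - 1) ∈ mu.SD := (StrictPartition.mem_SD _ _ _).2 (by omega)
    have := (StrictPartition.mem_SD _ _ _).1 (h this)
    omega

theorem SD_subset_of_subset {mu lam : StrictPartition} (h : mu ⊆ lam) : mu.SD ⊆ lam.SD := by
  rintro ⟨i, j⟩ hij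
  rw [StrictPartition.mem_SD] at *
  have := h i (by omega)
  omega

/-- In an order ideal of the shifted plane, the boxes of a row form an interval that starts on the
main diagonal. -/
theorem mem_iff_lt_card_row {D : Finset (ℤ × ℤ)} (hle : ∀ b ∈ D, 0 < b.1 ∧ b.1 ≤ b.2)
    (hideal : ∀ i j i' j' : ℤ, (i, j) ∈ D → 0 < i' → i' ≤ i → j' ≤ j → i' ≤ j' → (i', j') ∈ D)
    (i j : ℤ) : (i, j) ∈ D ↔ 0 < i ∧ i ≤ j ∧ j < i + #{b ∈ D | b.1 = i} := by
  constructor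
  · intro h
    obtain ⟨h₁, h₂⟩ := hle _ h
    refine ⟨h₁, h₂, ?_⟩
    have hsub : (Icc i j).image (fun k => (i, k)) ⊆ {b ∈ D | b.1 = i} := by
      intro b hb
      obtain ⟨k, hk, rfl⟩ := mem_image.1 hb
      obtain ⟨hk₁, hk₂⟩ := mem_Icc.1 hk
      exact mem_filter.2 ⟨hideal i j i k h h₁ le_rfl hk₂ hk₁, rfl⟩
    have := card_le_card hsub
    rw [card_image_of_injective _ (Prod.mk_right_injective i), Int.card_Icc] at this
    simp only at h₂
    omega
  · rintro ⟨h₁, h₂, h₃⟩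
    by_contra h
    have hsub : {b ∈ D | b.1 = i} ⊆ (Ico i j).image (fun k => (i, k)) := by
      rintro ⟨i', k⟩ hb
      obtain ⟨hm, rfl⟩ := mem_filter.1 hb
      refine mem_image.2 ⟨k, mem_Ico.2 ⟨(hle _ hm).2, ?_⟩, rfl⟩
      by_contra hk
      exact h (hideal _ _ _ _ hm h₁ le_rfl (by omega) h₂)
    have := card_le_card hsub
    rw [card_image_of_injective _ (Prod.mk_right_injective i), Int.card_Ico] at this
    omega

/-- Every finite order ideal of the shifted plane is the shifted diagram of a strict partition. -/
theorem exists_SD_eq {D : Finset (ℤ × ℤ)} (hle : ∀ b ∈ D, 0 < b.1 ∧ b.1 ≤ b.2)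
    (hideal : ∀ i j i' j' : ℤ, (i, j) ∈ D → 0 < i' → i' ≤ i → j' ≤ j → i' ≤ j' → (i', j') ∈ D) :
    ∃ lam : StrictPartition, lam.SD = D := by
  have hrow := mem_iff_lt_card_row hle hideal
  set r : ℤ → ℕ := fun i => #{b ∈ D | b.1 = i} with hr
  change ∀ i j, (i, j) ∈ D ↔ 0 < i ∧ i ≤ j ∧ j < i + r i at hrow
  have hstep : ∀ i : ℤ, 0 < i → 0 < r (i + 1) → r (i + 1) < r i := by
    intro i hi hpos
    have h : (i + 1, i + r (i + 1)) ∈ D := (hrow _ _).2 (by omega)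
    have := (hrow _ _).1 (hideal _ _ i (i + r (i + 1)) h hi (by omega) le_rfl (by omega))
    omega
  -- the number of nonempty rows
  obtain ⟨n, hn⟩ : ∃ n : ℕ, r (n + 1) = 0 ∧ ∀ k < n, r (k + 1) ≠ 0 := by
    have hex : ∃ n : ℕ, r (n + 1) = 0 := by
      refine ⟨D.sup fun b => b.1.toNat, card_eq_zero.2 (filter_eq_empty_iff.2 fun b hb h => ?_)⟩
      have : b.1.toNat ≤ D.sup fun b => b.1.toNat := le_sup (f := fun b : ℤ × ℤ => b.1.toNat) hb
      omega
    exact ⟨Nat.find hex, Nat.find_spec hex, fun k hk => Nat.find_min hex hk⟩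
  have hzero : ∀ k : ℕ, n ≤ k → r (k + 1) = 0 := by
    intro k hk
    induction k, hk using Nat.le_induction with
    | base => exact hn.1
    | succ k hk ih =>
      by_contra h
      have := hstep (k + 1) (by omega) (by push_cast at h; omega)
      omega
  have hanti : ∀ a b : ℕ, a < b → b < n → r (b + 1) < r (a + 1) := by
    intro a b hab
    induction b, hab using Nat.le_induction with
    | base =>
      intro hb
      have := hn.2 _ hb
      have := hstep (a + 1) (by omega) (by push_cast at this; omega)
      push_cast
      omega
    | succ b hab ih =>
      intro hb
      have h₁ := ih (by omega)
      have := hn.2 _ hb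
      have := hstep (b + 1) (by omega) (by push_cast at this; omega)
      push_cast
      omega
  refine ⟨⟨(List.range n).map fun k : ℕ => r (k + 1), ?_, ?_⟩, ?_⟩
  · rw [List.pairwise_iff_getElem]
    intro a b ha hb hab
    simp only [List.getElem_map, List.getElem_range]
    exact hanti a b hab (by simpa using hb)
  · intro p hp
    obtain ⟨k, hk, rfl⟩ := List.mem_map.1 hp
    exact Nat.pos_of_ne_zero (hn.2 k (List.mem_range.1 hk))
  · ext ⟨i, j⟩
    rw [StrictPartition.mem_SD, hrow]
    refine and_congr_right fun hi => ?_
    suffices h : StrictPartition.part ⟨(List.range n).map fun k : ℕ => r (k + 1), _, _⟩ i = r i by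
      rw [h]
    obtain ⟨k, rfl⟩ : ∃ k : ℕ, i = k + 1 := ⟨(i - 1).toNat, by omega⟩
    simp only [StrictPartition.part]
    rw [show ((k : ℤ) + 1 - 1).toNat = k by omega]
    by_cases hk : k < n
    · rw [List.getD_eq_getElem _ _ (by simpa using hk)]
      simp
    · rw [List.getD_eq_default _ _ (by simpa using hk), hzero k (by omega)]

/-- The complement of a shifted diagram in a staircase, reflected: this is again a shifted
diagram. -/
theorem exists_SD_complement (lam : StrictPartition) (n : ℕ) :
    ∃ nu : StrictPartition, ∀ i j : ℤ, (i, j) ∈ nu.SD ↔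
      0 < i ∧ i ≤ j ∧ j ≤ n ∧ SkewShape.reflect (n + 1) (i, j) ∉ lam.SD := by
  set D := (Icc (1 : ℤ) n ×ˢ Icc (1 : ℤ) n).filter
    (fun b => b.1 ≤ b.2 ∧ SkewShape.reflect (n + 1) b ∉ lam.SD) with hD
  have hmem : ∀ i j : ℤ, (i, j) ∈ D ↔
      0 < i ∧ i ≤ j ∧ j ≤ n ∧ SkewShape.reflect (n + 1) (i, j) ∉ lam.SD := by
    intro i j
    simp only [hD, mem_filter, mem_product, mem_Icc]
    constructor
    · rintro ⟨⟨h₁, h₂⟩, h₃, h₄⟩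
      exact ⟨by omega, h₃, by omega, h₄⟩
    · rintro ⟨h₁, h₂, h₃, h₄⟩
      exact ⟨by omega, h₂, h₄⟩
  have hle : ∀ b ∈ D, 0 < b.1 ∧ b.1 ≤ b.2 := by
    rintro ⟨i, j⟩ hb
    obtain ⟨h₁, h₂, -⟩ := (hmem _ _).1 hb
    exact ⟨h₁, h₂⟩
  obtain ⟨nu, h⟩ := exists_SD_eq hle fun i j i' j' h h₁ h₂ h₃ h₄ => by
    obtain ⟨h₅, h₆, h₇, h₈⟩ := (hmem _ _).1 h
    exact (hmem _ _).2 ⟨h₁, h₄, by omega, fun h₉ => h₈ (mem_SD_of_le h₉ (by omega) (by omega)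
      (by omega) (by omega))⟩
  exact ⟨nu, fun i j => by rw [h, hmem]⟩

theorem exists_isFlip (S : SkewShape) : ∃ S' : SkewShape, SkewShape.IsFlip S S' := by
  -- a staircase which contains the outer diagram
  obtain ⟨n, hn⟩ : ∃ n : ℕ, ∀ b ∈ S.outer.SD, b.2 ≤ n := by
    refine ⟨S.outer.SD.sup fun b => b.2.toNat, fun b hb => ?_⟩
    have : b.2.toNat ≤ S.outer.SD.sup fun b => b.2.toNat :=
      le_sup (f := fun b : ℤ × ℤ => b.2.toNat) hb
    omega
  obtain ⟨nu, hnu⟩ := exists_SD_complement S.inner n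
  obtain ⟨ka, hka⟩ := exists_SD_complement S.outer n
  have hsub : ka ⊆ nu := by
    refine subset_of_SD_subset ?_
    rintro ⟨i, j⟩ h
    obtain ⟨h₁, h₂, h₃, h₄⟩ := (hka i j).1 h
    exact (hnu i j).2 ⟨h₁, h₂, h₃, fun h => h₄ (SD_subset_of_subset S.sub h)⟩
  refine ⟨⟨nu, ka, hsub⟩, n + 1, ?_⟩
  ext ⟨i, j⟩
  have h₁ : (i, j) ∈ S.SD.image (SkewShape.reflect (n + 1)) ↔
      SkewShape.reflect (n + 1) (i, j) ∈ S.SD := by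
    rw [mem_image]
    constructor
    · rintro ⟨a, ha, h⟩
      rwa [← h, reflect_reflect]
    · exact fun h => ⟨_, h, reflect_reflect _ _⟩
  rw [h₁, SkewShape.SD, SkewShape.SD, mem_sdiff, mem_sdiff, hnu, hka]
  constructor
  · rintro ⟨⟨h₁, h₂, h₃, h₄⟩, h₅⟩
    exact ⟨by_contra fun h => h₅ ⟨h₁, h₂, h₃, h⟩, h₄⟩
  · rintro ⟨h₁, h₂⟩
    have h₃ := hn _ h₁
    have h₄ := (StrictPartition.mem_SD _ _ _).1 h₁
    simp only [SkewShape.reflect] at h₃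
    exact ⟨⟨by omega, by omega, by omega, h₂⟩, fun h => h.2.2.2 h₁⟩

end ShiftedShape

end

theorem mainTheorem8 (lam mu : StrictPartition) (h : mu ⊆ lam) :
    (∃ S' : SkewShape, SkewShape.IsFlip ⟨lam, mu, h⟩ S') ∧
    ∀ S' : SkewShape, SkewShape.IsFlip ⟨lam, mu, h⟩ S' →
      GP S' = GP ⟨lam, mu, h⟩ ∧ GQ S' = GQ ⟨lam, mu, h⟩ := by
  refine ⟨ShiftedShape.exists_isFlip _, fun S' hS' => ?_⟩
  have hP : ∀ S, SetShYTP S = ShiftedShape.tableaux True S := fun S => by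
    ext T
    simp [SetShYTP, ShiftedShape.tableaux]
  have hQ : ∀ S, SetShYTQ S = ShiftedShape.tableaux False S := fun S => by
    ext T
    simp [SetShYTQ, ShiftedShape.tableaux]
  rw [GP, GP, GQ, GQ, hP, hP, hQ, hQ]
  exact ⟨ShiftedShape.tableauGenFun_eq_of_isFlip True (ShiftedShape.isShape_SD _)
      (ShiftedShape.isShape_SD _) hS',
    ShiftedShape.tableauGenFun_eq_of_isFlip False (ShiftedShape.isShape_SD _)
      (ShiftedShape.isShape_SD _) hS'⟩
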